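/- States are pure states of four qubits, i.e. nonzero vectors of $(\mathbb C^2)^{\otimes 4}$; normalization and global phase are ignored. Let $X,Y,Z$ be the Pauli matrices. For $a,b,c,d\in\mathbb C$ let $$|\Psi\rangle=\tfrac{a+d}{2}(|0000\rangle+|1111\rangle)+\tfrac{a-d}{2}(|0011\rangle+|1100\rangle)+\tfrac{b+c}{2}(|0101\rangle+|1010\rangle)+\tfrac{b-c}{2}(|0110\rangle+|1001\rangle)$$ be the corresponding seed state. The seed state is called generic if $a\neq\pm b$, $a\ne\pm c$, $a\ne \pm d$, $b\ne\pm c$, $b\ne\pm d$, $c\neq\pm d$ and there is no complex $q\neq1$ with $\{qa^2,qb^2,qc^2,qd^2\}=\{a^2,b^2,c^2,d^2\}$. A generic state is a state $h|\Psi\rangle$ with $|\Psi\rangle$ a generic seed state and $h=h^1\otimes h^2\otimes h^3\otimes h^4$, $h^i\in GL(2,\mathbb C)$. Two states are LU-equivalent if a local unitary maps one to a nonzero multiple of the other. A state is reachable if it can be obtained, deterministically and by a (finite-round) LOCC protocol, from some four-qubit state that is not LU-equivalent to it. The maximally entangled set $MES_4$ is the set of truly four-partite entangled states (not a product across any bipartition)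 that are not reachable. For $W\in\{X,Y,Z\}$, with $w$ the corresponding letter, say that $h^i$ is of the form $h_w^i$ if $uh^i\in\operatorname{span}_{\mathbb C}\{\mathbb 1,W\}$ for some unitary $u$, and that $h^i$ is trivial if $uh^i\propto\mathbb 1$ for some unitary $u$ (operators matter only up to unitaries on the left, i.e. up to LU). **Theorem.** 1. Let $|\Psi\rangle$ be a generic seed state and $h=h^1\otimes h^2\otimes h^3\otimes h^4$ with $h^i\in GL(2,\mathbb C)$. Then $h|\Psi\rangle$ is reachable if and only if, up to a permutation of the parties, one of the following holds: (a) for one $w\in\{x,y,z\}$, $h^2,h^3,h^4$ are of the form $h_w^2,h_w^3,h_w^4$ and $h^1$ is not of the form $h_w^1$; (b) $h^2,h^3,h^4$ are trivial and $h^1$ is not trivial. 2. The reachable generic states form a family with only 12 real parameters: there are finitely many smooth maps from $\mathbb R^{12}$ to $(\mathbb C^2)^{\otimes4}$ such that every reachable generic state is LU-equivalent to a point in the image of one of them. 3. Almost all generic four-qubit states lie in $MES_4$: the set of generic states that are not in $MES_4$ has Lebesgue measure zero in $(\mathbb C^2)^{\otimes4}$. -/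

import Mathlib

open MeasureTheory
open scoped ContDiff Matrix

noncomputable section

/-- Pure states (not necessarily normalised) of `n` parties with local dimensions `d i`:
the amplitudes in the product basis. -/
abbrev QState {n : ℕ} (d : Fin n → ℕ) : Type := ((i : Fin n) → Fin (d i)) → ℂ

/-- Pure states of `n` qubits, an element of `(ℂ²)^{⊗ n}`. -/
abbrev QubitState (n : ℕ) : Type := QState (fun _ : Fin n => 2)

/-- The action of the local operator `A 0 ⊗ A 1 ⊗ ⋯ ⊗ A (n-1)` on a state. -/
def localOp {n : ℕ} {d e : Fin n → ℕ} (A : (i : Fin n) → Matrix (Fin (e i)) (Fin (d i)) ℂ)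
    (φ : QState d) : QState e :=
  fun y => ∑ x, (∏ i, A i (y i) (x i)) * φ x

/-- `LOCCReaches ψ φ`: the (unnormalised) state `φ` can be transformed deterministically into `ψ`
by LOCC. A derivation is a finite-round protocol. In a round one party `p` performs a local
measurement with finitely many outcomes and Kraus operators `A k p` and announces the outcome `k`;
each other party then applies a local isometry `A k j` that depends on `k`. The rest of
the protocol may depend on everything announced so far, and local dimensions may change on the way
(ancillas may be adjoined and discarded). In each branch the protocol ends with a multiple of `ψ`
(the zero multiple for a branch of probability zero). -/
inductive LOCCReaches {n : ℕ} {t : Fin n → ℕ} (ψ : QState t) :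
    {d : Fin n → ℕ} → QState d → Prop
  | done (c : ℂ) : LOCCReaches ψ (c • ψ)
  | round {d : Fin n → ℕ} (φ : QState d) (p : Fin n) (m : ℕ) (e : Fin m → Fin n → ℕ)
      (A : (k : Fin m) → (j : Fin n) → Matrix (Fin (e k j)) (Fin (d j)) ℂ)
      (measurement : ∑ k, (A k p)ᴴ * A k p = 1)
      (isometries : ∀ k j, j ≠ p → (A k j)ᴴ * A k j = 1)
      (next : ∀ k, LOCCReaches ψ (localOp (A k) φ)) : LOCCReaches ψ φ

/-- LU-equivalence of `n`-qubit states; normalisation and global phase are ignored. -/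
def LUEquiv {n : ℕ} (φ ψ : QubitState n) : Prop :=
  ∃ (u : Fin n → Matrix.unitaryGroup (Fin 2) ℂ) (c : ℂ), c ≠ 0 ∧
    ψ = c • localOp (fun i => (u i : Matrix (Fin 2) (Fin 2) ℂ)) φ

/-- `ψ` can be reached by deterministic LOCC from some `n`-qubit state that is not LU-equivalent
to `ψ`. -/
def ReachableFromOther {n : ℕ} (ψ : QubitState n) : Prop :=
  ∃ φ : QubitState n, φ ≠ 0 ∧ ¬ LUEquiv φ ψ ∧ LOCCReaches ψ φ

/-- Truly `n`-partite entangled: nonzero, and not a product across any bipartition. -/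
def TrulyEntangled {n : ℕ} (φ : QubitState n) : Prop :=
  φ ≠ 0 ∧ ∀ S : Set (Fin n), S.Nonempty → Sᶜ.Nonempty →
    ¬ ∃ (f : (S → Fin 2) → ℂ) (g : ((Sᶜ : Set (Fin n)) → Fin 2) → ℂ),
      ∀ x : Fin n → Fin 2, φ x = f (fun i => x i) * g (fun i => x i)

/-- A set `M` of truly entangled `n`-qubit states (a union of LU classes) is a maximally entangled
set if no state in `M` can be obtained by LOCC from an LU-inequivalent state, and each
truly entangled state outside `M` can be obtained by LOCC from a state in `M`. -/
structure IsMaximallyEntangledSet {n : ℕ} (M : Set (QubitState n)) : Prop where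
  trulyEntangled : ∀ φ ∈ M, TrulyEntangled φ
  lu_closed : ∀ φ ∈ M, ∀ ψ, TrulyEntangled ψ → LUEquiv φ ψ → ψ ∈ M
  not_reachable : ∀ φ ∈ M, ¬ ReachableFromOther φ
  reaches : ∀ ψ, TrulyEntangled ψ → ψ ∉ M → ∃ φ ∈ M, LOCCReaches ψ φ

/-- The maximally entangled set of `n` qubits: the truly entangled states that cannot be obtained
by LOCC from any LU-inequivalent state. It is the only set that can satisfy
`IsMaximallyEntangledSet`, see the next lemma. -/
def MES (n : ℕ) : Set (QubitState n) :=
  {φ | TrulyEntangled φ ∧ ¬ ReachableFromOther φ}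

theorem IsMaximallyEntangledSet.eq_MES {n : ℕ} {M : Set (QubitState n)}
    (hM : IsMaximallyEntangledSet M) : M = MES n := by
  ext ψ
  refine ⟨fun h => ⟨hM.trulyEntangled ψ h, hM.not_reachable ψ h⟩, fun h => ?_⟩
  by_contra hψ
  obtain ⟨φ, hφ, hr⟩ := hM.reaches ψ h.1 hψ
  refine h.2 ⟨φ, (hM.trulyEntangled φ hφ).1, fun hlu => hψ ?_, hr⟩
  exact hM.lu_closed φ hφ ψ h.1 hlu

/-- The Pauli matrices `X, Y, Z`. -/
def pauli : Fin 3 → Matrix (Fin 2) (Fin 2) ℂ :=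
  ![!![0, 1; 1, 0], !![0, -Complex.I; Complex.I, 0], !![1, 0; 0, -1]]

/-- The computational basis state `|i j k l⟩` of four qubits. -/
def ket (i j k l : Fin 2) : QubitState 4 := Pi.single ![i, j, k, l] 1

/-- The seed state of the class `G_abcd`, with `(a, b, c, d) = (z 0, z 1, z 2, z 3)`. -/
def seed (z : Fin 4 → ℂ) : QubitState 4 :=
  ((z 0 + z 3) / 2) • (ket 0 0 0 0 + ket 1 1 1 1) +
  ((z 0 - z 3) / 2) • (ket 0 0 1 1 + ket 1 1 0 0) +
  ((z 1 + z 2) / 2) • (ket 0 1 0 1 + ket 1 0 1 0) +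
  ((z 1 - z 2) / 2) • (ket 0 1 1 0 + ket 1 0 0 1)

/-- Generic seed parameters: `a ≠ ±b` and so on for each pair, and the set `{a², b², c², d²}` is not
mapped to itself by multiplication with any `q ≠ 1`. -/
def IsGenericSeed (z : Fin 4 → ℂ) : Prop :=
  (∀ i j, i ≠ j → z i ≠ z j ∧ z i ≠ -z j) ∧
  ∀ q : ℂ, q ≠ 1 → (fun s => q * s) '' Set.range (fun i => z i ^ 2) ≠ Set.range (fun i => z i ^ 2)

/-- The state `h |Ψ⟩` with `h = h 0 ⊗ h 1 ⊗ h 2 ⊗ h 3` and `|Ψ⟩` the seed state with parameters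
`z`. -/
def seedOrbit (h : Fin 4 → GL (Fin 2) ℂ) (z : Fin 4 → ℂ) : QubitState 4 :=
  localOp (fun i => (h i : Matrix (Fin 2) (Fin 2) ℂ)) (seed z)

/-- Generic four-qubit states: `h |Ψ⟩` with `h` local invertible and `|Ψ⟩` a generic seed state. -/
def IsGenericState (φ : QubitState 4) : Prop :=
  ∃ (h : Fin 4 → GL (Fin 2) ℂ) (z : Fin 4 → ℂ), IsGenericSeed z ∧ φ = seedOrbit h z

/-- Up to a unitary on the left (an LU on the state), `g` lies in the span of `1` and the Pauli
matrix `W = pauli w`. -/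
def IsPauliForm (w : Fin 3) (g : GL (Fin 2) ℂ) : Prop :=
  ∃ u : Matrix.unitaryGroup (Fin 2) ℂ, (u : Matrix (Fin 2) (Fin 2) ℂ) * g.val ∈
    Submodule.span ℂ {1, pauli w}

/-- Up to a unitary on the left (an LU on the state), `g` is proportional to the identity. -/
def IsTrivialForm (g : GL (Fin 2) ℂ) : Prop :=
  ∃ (u : Matrix.unitaryGroup (Fin 2) ℂ) (c : ℂ),
    (u : Matrix (Fin 2) (Fin 2) ℂ) * g.val = c • (1 : Matrix (Fin 2) (Fin 2) ℂ)

end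

/-! Group the parties as 01|23. In the Bell bases of the two pairs the seed is the diagonal matrix
with entries `z s / 2`, and the operators of a pair act by a matrix `O` that preserves, up to a
factor, the bilinear form polarising the determinant. If they belong to a symmetry of the seed, `O`
commutes up to a scalar with the diagonal matrix of the `z s ^ 2`. Genericity makes this scalar 1
and `O` diagonal, so the only local symmetries are the four `W ⊗ W ⊗ W ⊗ W`
(`IsGenericSeed.symmetry`).

In a protocol from `BΨ` to `hΨ` every branch of nonzero probability therefore ends with the Gram
operator of some `hW ⊗ hW ⊗ hW ⊗ hW`. Completeness of the measurements makes the Gram operator of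
`B` a nonnegative combination of these (`LOCCReaches.isPauliMixture`). In Bloch coordinates
conjugation by `W` only flips signs. Both sides of the identity are built from product vectors, and
comparing marginals of one, two and three parties leaves two cases (`sign_or_axis`): the mixture
acts as one conjugation, and source and target are LU-equivalent; or three target Bloch vectors lie
on a common axis and the fourth does not. In the second case a measurement with two outcomes related
by `W` creates the transverse components of the fourth vector (`reachable_of_one_party`).
Alternative (b) is an instance of (a).

Up to LU and scalars the exceptional party has 3 real parameters, the other three have 1 each, and
the seed has 6, in total 12. Four unitaries and a scalar raise this to at most 30, below the 32 real
dimensions of the state space. Product states have at most 20 parameters. Smooth images of spaces of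
smaller dimension are null sets. -/

/-! ### Algebra of product operators -/

section LocalOperators

variable {n : ℕ} {d e f : Fin n → ℕ}

theorem localOp_localOp (A : (i : Fin n) → Matrix (Fin (f i)) (Fin (e i)) ℂ)
    (B : (i : Fin n) → Matrix (Fin (e i)) (Fin (d i)) ℂ) (φ : QState d) :
    localOp A (localOp B φ) = localOp (fun i => A i * B i) φ := by
  funext y
  simp only [localOp, Finset.mul_sum]
  rw [Finset.sum_comm]
  refine Finset.sum_congr rfl fun x _ => ?_
  simp only [Matrix.mul_apply]
  rw [Finset.prod_univ_sum, Fintype.piFinset_univ, Finset.sum_mul]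
  refine Finset.sum_congr rfl fun w _ => ?_
  rw [Finset.prod_mul_distrib]
  ring

theorem localOp_one (φ : QState d) :
    localOp (fun i => (1 : Matrix (Fin (d i)) (Fin (d i)) ℂ)) φ = φ := by
  funext y
  simp only [localOp]
  rw [Finset.sum_eq_single y]
  · simp
  · intro x _ hx
    obtain ⟨i, hi⟩ := Function.ne_iff.mp hx
    rw [Finset.prod_eq_zero (Finset.mem_univ i), zero_mul]
    exact Matrix.one_apply_ne (Ne.symm hi)
  · simp

theorem localOp_smul_state (A : (i : Fin n) → Matrix (Fin (e i)) (Fin (d i)) ℂ) (c : ℂ)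
    (φ : QState d) : localOp A (c • φ) = c • localOp A φ := by
  funext y
  simp only [localOp, Pi.smul_apply, smul_eq_mul, Finset.mul_sum]
  exact Finset.sum_congr rfl fun x _ => by ring

theorem localOp_zero_state (A : (i : Fin n) → Matrix (Fin (e i)) (Fin (d i)) ℂ) :
    localOp A (0 : QState d) = 0 := by
  funext y
  simp [localOp]

theorem localOp_smul_op (c : Fin n → ℂ) (A : (i : Fin n) → Matrix (Fin (e i)) (Fin (d i)) ℂ)
    (φ : QState d) : localOp (fun i => c i • A i) φ = (∏ i, c i) • localOp A φ := by
  funext y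
  simp only [localOp, Pi.smul_apply, Matrix.smul_apply, smul_eq_mul, Finset.mul_sum,
    Finset.prod_mul_distrib]
  exact Finset.sum_congr rfl fun x _ => by ring

theorem localOp_eq_zero_of_eq_zero (A : (i : Fin n) → Matrix (Fin (e i)) (Fin (d i)) ℂ)
    (p : Fin n) (hp : A p = 0) (φ : QState d) : localOp A φ = 0 := by
  funext y
  simp only [localOp]
  refine Finset.sum_eq_zero fun x _ => ?_
  rw [Finset.prod_eq_zero (Finset.mem_univ p), zero_mul]
  simp [hp]

theorem sum_localOp_update {ι : Type*} (s : Finset ι)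
    (A : (i : Fin n) → Matrix (Fin (e i)) (Fin (d i)) ℂ)
    (p : Fin n) (M : ι → Matrix (Fin (e p)) (Fin (d p)) ℂ) (φ : QState d) :
    ∑ k ∈ s, localOp (Function.update A p (M k)) φ =
      localOp (Function.update A p (∑ k ∈ s, M k)) φ := by
  funext y
  simp only [localOp, Finset.sum_apply]
  rw [Finset.sum_comm]
  refine Finset.sum_congr rfl fun x _ => ?_
  rw [← Finset.sum_mul]
  congr 1
  have key : ∀ N : Matrix (Fin (e p)) (Fin (d p)) ℂ,
      ∏ i, Function.update A p N i (y i) (x i) =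
        N (y p) (x p) * ∏ i ∈ Finset.univ.erase p, A i (y i) (x i) := by
    intro N
    rw [← Finset.mul_prod_erase _ _ (Finset.mem_univ p), Function.update_self]
    congr 1
    refine Finset.prod_congr rfl fun i hi => ?_
    rw [Function.update_of_ne (Finset.ne_of_mem_erase hi)]
  simp only [key, Matrix.sum_apply, Finset.sum_mul]

/-- A local measurement followed by local isometries does not annihilate a nonzero state in every
branch. -/
theorem exists_localOp_ne_zero {p : Fin n} {m : ℕ} {e : Fin m → Fin n → ℕ}
    {A : (k : Fin m) → (j : Fin n) → Matrix (Fin (e k j)) (Fin (d j)) ℂ}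
    (measurement : ∑ k, (A k p)ᴴ * A k p = 1)
    (isometries : ∀ k j, j ≠ p → (A k j)ᴴ * A k j = 1) {φ : QState d} (hφ : φ ≠ 0) :
    ∃ k, localOp (A k) φ ≠ 0 := by
  by_contra! h
  apply hφ
  -- Applying the adjoint of a branch operator cancels the isometries and leaves `(A k p)ᴴ * A k p`
  -- at `p`; these operators sum to the identity.
  have h1 : ∀ k, localOp (Function.update
      (fun i => (1 : Matrix (Fin (d i)) (Fin (d i)) ℂ)) p ((A k p)ᴴ * A k p)) φ = 0 := by
    intro k
    have : Function.update (fun i => (1 : Matrix (Fin (d i)) (Fin (d i)) ℂ)) p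
        ((A k p)ᴴ * A k p) = fun j => (A k j)ᴴ * A k j := by
      funext j
      by_cases hj : j = p
      · subst hj; simp
      · rw [Function.update_of_ne hj, isometries k j hj]
    rw [this, ← localOp_localOp, h k, localOp_zero_state]
  have h2 := sum_localOp_update Finset.univ
    (fun i => (1 : Matrix (Fin (d i)) (Fin (d i)) ℂ)) p (fun k => (A k p)ᴴ * A k p) φ
  rw [measurement, Finset.sum_eq_zero (fun k _ => h1 k), Function.update_eq_self_iff.mpr rfl,
    localOp_one] at h2
  exact h2.symm

end LocalOperators

/-! ### The seed state in the Bell basis -/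

section Seed

/-- The matrices `1, X, iY, Z`; as vectors of two qubits they form the Bell basis. -/
def bellOp : Fin 4 → Matrix (Fin 2) (Fin 2) ℂ :=
  ![1, !![0, 1; 1, 0], !![0, 1; -1, 0], !![1, 0; 0, -1]]

theorem sum_fin_four_fun (F : (Fin 4 → Fin 2) → ℂ) :
    ∑ x, F x = ∑ i, ∑ j, ∑ k, ∑ l, F ![i, j, k, l] := by
  let E : (Fin 2 × Fin 2 × Fin 2 × Fin 2) ≃ (Fin 4 → Fin 2) :=
    { toFun := fun t => ![t.1, t.2.1, t.2.2.1, t.2.2.2]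
      invFun := fun x => (x 0, x 1, x 2, x 3)
      left_inv := fun _ => rfl
      right_inv := fun x => by funext i; fin_cases i <;> rfl }
  rw [← E.sum_comp]
  simp only [Fintype.sum_prod_type]
  rfl

theorem ket_apply (i j k l a b c e : Fin 2) :
    ket i j k l ![a, b, c, e] = if a = i ∧ b = j ∧ c = k ∧ e = l then 1 else 0 := by
  simp [ket, Pi.single_apply]

/-- With the parties grouped as 01|23 the seed is diagonal in the products of Bell vectors. -/
theorem seed_apply (z : Fin 4 → ℂ) (i j k l : Fin 2) :
    seed z ![i, j, k, l] = (1 / 2) * ∑ s, z s * (bellOp s i j * bellOp s k l) := by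
  simp only [seed, Pi.add_apply, Pi.smul_apply, ket_apply, Fin.sum_univ_four, bellOp]
  fin_cases i <;> fin_cases j <;> fin_cases k <;> fin_cases l <;> simp <;> ring

/-- On a two-qubit vector written as a matrix `M`, the operator `A ⊗ B` acts as `A * M * Bᵀ`. -/
theorem localOp_seed_apply (A : Fin 4 → Matrix (Fin 2) (Fin 2) ℂ) (z : Fin 4 → ℂ)
    (i j k l : Fin 2) :
    localOp A (seed z) ![i, j, k, l] = (1 / 2) * ∑ s, z s *
      ((A 0 * bellOp s * (A 1)ᵀ) i j * (A 2 * bellOp s * (A 3)ᵀ) k l) := by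
  simp only [localOp, sum_fin_four_fun, seed_apply, Fin.prod_univ_four, Matrix.mul_apply,
    Matrix.transpose_apply, Fin.sum_univ_two, Fin.sum_univ_four]
  simp only [Matrix.cons_val]
  ring

/-- Taking `iY` instead of `Y` keeps the matrices real, so the transpose is both inverse and
adjoint. -/
theorem bellOp_mul_transpose (s : Fin 4) : bellOp s * (bellOp s)ᵀ = 1 := by
  fin_cases s <;> ext i j <;> fin_cases i <;> fin_cases j <;> simp [bellOp, Matrix.mul_apply]

theorem bellOp_transpose_mul (s : Fin 4) : (bellOp s)ᵀ * bellOp s = 1 :=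
  mul_eq_one_comm.mp (bellOp_mul_transpose s)

theorem bellOp_conjTranspose (s : Fin 4) : (bellOp s)ᴴ = (bellOp s)ᵀ := by
  fin_cases s <;> ext i j <;> fin_cases i <;> fin_cases j <;> simp [bellOp]

/-- The Bell basis is linearly independent. -/
theorem eq_zero_of_sum_bellOp {c : Fin 4 → ℂ} (h : ∀ i j, ∑ s, c s * bellOp s i j = 0) :
    c = 0 := by
  have h00 := h 0 0
  have h01 := h 0 1
  have h10 := h 1 0
  have h11 := h 1 1
  simp [Fin.sum_univ_four, bellOp] at h00 h01 h10 h11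
  funext s
  fin_cases s <;> simp
  · linear_combination (h00 + h11) / 2
  · linear_combination (h01 + h10) / 2
  · linear_combination (h01 - h10) / 2
  · linear_combination (h00 - h11) / 2

/-- A generic seed may have one vanishing parameter, but not two. -/
theorem IsGenericSeed.exists_ne_zero {z : Fin 4 → ℂ} (hz : IsGenericSeed z) {i j : Fin 4}
    (hij : i ≠ j) : z i ≠ 0 ∨ z j ≠ 0 := by
  by_contra! h
  exact (hz.1 i j hij).1 (h.1.trans h.2.symm)

/-- A generic seed state has full local rank at each party. -/
theorem eq_zero_of_localOp_update_one {z : Fin 4 → ℂ} (hz : IsGenericSeed z) (p : Fin 4)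
    (M : Matrix (Fin 2) (Fin 2) ℂ)
    (h : localOp (Function.update (fun _ => 1) p M : Fin 4 → Matrix (Fin 2) (Fin 2) ℂ) (seed z) = 0) :
    M = 0 := by
  obtain ⟨t, ht⟩ : ∃ t, z t ≠ 0 := by
    rcases hz.exists_ne_zero (i := 0) (j := 1) (by decide) with h | h
    exacts [⟨_, h⟩, ⟨_, h⟩]
  set U : Fin 4 → Matrix (Fin 2) (Fin 2) ℂ := Function.update (fun _ => 1) p M with hU
  have key : ∀ i j k l, ∑ s, z s *
      ((U 0 * bellOp s * (U 1)ᵀ) i j * (U 2 * bellOp s * (U 3)ᵀ) k l) = 0 := by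
    intro i j k l
    have := congrFun h ![i, j, k, l]
    rw [localOp_seed_apply] at this
    simpa using this
  have cancel_right : M * bellOp t = 0 → M = 0 := fun h0 => by
    rw [← mul_one M, ← bellOp_mul_transpose t, ← mul_assoc, h0, zero_mul]
  have cancel_left : bellOp t * Mᵀ = 0 → M = 0 := fun h0 => by
    rw [← Matrix.transpose_eq_zero, ← one_mul Mᵀ, ← bellOp_transpose_mul t, mul_assoc, h0,
      mul_zero]
  -- The pair without `p` is untouched; independence of its Bell vectors isolates the term `t`,
  -- where `z t ≠ 0`.
  have first : ∀ P : Fin 4 → Matrix (Fin 2) (Fin 2) ℂ,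
      (∀ i j k l, ∑ s, z s * (P s i j * bellOp s k l) = 0) → P t = 0 := by
    intro P hP
    ext i j
    have := congrFun (eq_zero_of_sum_bellOp (c := fun s => z s * P s i j)
      (fun k l => by simpa only [mul_assoc] using hP i j k l)) t
    simpa [ht] using this
  have second : ∀ P : Fin 4 → Matrix (Fin 2) (Fin 2) ℂ,
      (∀ i j k l, ∑ s, z s * (bellOp s i j * P s k l) = 0) → P t = 0 := fun P hP =>
    first P fun i j k l => by simpa only [mul_comm (P _ i j)] using hP k l i j
  fin_cases p
  · refine cancel_right (first (fun s => M * bellOp s) fun i j k l => ?_)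
    simpa [hU, Function.update] using key i j k l
  · refine cancel_left (first (fun s => bellOp s * Mᵀ) fun i j k l => ?_)
    simpa [hU, Function.update] using key i j k l
  · refine cancel_right (second (fun s => M * bellOp s) fun i j k l => ?_)
    simpa [hU, Function.update] using key i j k l
  · refine cancel_left (second (fun s => bellOp s * Mᵀ) fun i j k l => ?_)
    simpa [hU, Function.update] using key i j k l

/-- If a local operator that is left invertible at all parties but `p` annihilates a generic seed
state, then its factor at `p` vanishes. -/
theorem eq_zero_of_localOp_seed {z : Fin 4 → ℂ} (hz : IsGenericSeed z) {d : Fin 4 → ℕ}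
    (B : (i : Fin 4) → Matrix (Fin (d i)) (Fin 2) ℂ) (p : Fin 4)
    (L : (i : Fin 4) → Matrix (Fin 2) (Fin (d i)) ℂ) (hL : ∀ i, i ≠ p → L i * B i = 1)
    (h : localOp B (seed z) = 0) : B p = 0 := by
  have key : ∀ R : Matrix (Fin 2) (Fin (d p)) ℂ, R * B p = 0 := by
    intro R
    apply eq_zero_of_localOp_update_one hz p
    have : Function.update (fun _ => 1) p (R * B p) =
        fun i => (Function.update L p R i) * B i := by
      funext i
      by_cases hi : i = p
      · subst hi; simp
      · rw [Function.update_of_ne hi, Function.update_of_ne hi, hL i hi]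
    rw [this, ← localOp_localOp (d := fun _ => 2), h, localOp_zero_state]
  ext y a
  have := congrFun (congrFun (key (Matrix.single 0 y 1)) 0) a
  simpa using this

theorem seed_ne_zero {z : Fin 4 → ℂ} (hz : IsGenericSeed z) : seed z ≠ 0 := by
  intro h
  have := eq_zero_of_localOp_update_one hz 0 1 (by rw [h, localOp_zero_state])
  exact one_ne_zero this

/-- Conjugation by `bellOp s` changes each Bell vector by a sign, which occurs once in each pair and
squares to 1. -/
theorem localOp_bellOp_seed (s : Fin 4) (z : Fin 4 → ℂ) :
    localOp (fun _ => bellOp s) (seed z) = seed z := by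
  funext x
  obtain ⟨i, j, k, l, rfl⟩ : ∃ i j k l, x = ![i, j, k, l] :=
    ⟨x 0, x 1, x 2, x 3, by funext i; fin_cases i <;> rfl⟩
  rw [localOp_seed_apply, seed_apply]
  congr 1
  refine Finset.sum_congr rfl fun t _ => ?_
  congr 1
  fin_cases s <;> fin_cases t <;> fin_cases i <;> fin_cases j <;> fin_cases k <;> fin_cases l <;>
    simp [bellOp, Matrix.mul_apply]

end Seed

/-! ### Local symmetries of a generic seed -/

section Stabilizer

/-- The matrix of `A ⊗ B` with respect to the Bell basis. -/
noncomputable def bellMatrix (A B : Matrix (Fin 2) (Fin 2) ℂ) : Matrix (Fin 4) (Fin 4) ℂ :=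
  Matrix.of fun s t => (1 / 2) * ∑ i, ∑ j, bellOp s i j * (A * bellOp t * Bᵀ) i j

/-- The bilinear form `ε ⊗ ε` in the Bell basis. -/
noncomputable def bellForm : Matrix (Fin 4) (Fin 4) ℂ := Matrix.diagonal ![1, -1, 1, -1]

/-- The form polarises the determinant of 2 × 2 matrices, and `M ↦ A * M * Bᵀ` scales the
determinant by `A.det * B.det`. The diagonal entries of `bellForm` are the determinants of the
`bellOp s`. -/
theorem bellMatrix_form (A B : Matrix (Fin 2) (Fin 2) ℂ) :
    (bellMatrix A B)ᵀ * bellForm * bellMatrix A B = (A.det * B.det) • bellForm := by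
  ext s t
  simp only [bellForm, Matrix.mul_apply, Fin.sum_univ_four,
    Matrix.smul_apply, Matrix.det_fin_two, bellMatrix, Matrix.transpose_apply, Matrix.of_apply,
    Fin.sum_univ_two, smul_eq_mul]
  fin_cases s <;> fin_cases t <;> simp [bellOp] <;> ring

theorem bellMatrix_diagonal {A : Fin 4 → Matrix (Fin 2) (Fin 2) ℂ} {z : Fin 4 → ℂ} {c : ℂ}
    (h : localOp A (seed z) = c • seed z) :
    bellMatrix (A 0) (A 1) * Matrix.diagonal z * (bellMatrix (A 2) (A 3))ᵀ =
      c • Matrix.diagonal z := by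
  have key : ∀ i j k l, ∑ s, z s *
      ((A 0 * bellOp s * (A 1)ᵀ) i j * (A 2 * bellOp s * (A 3)ᵀ) k l) =
        c * ∑ s, z s * (bellOp s i j * bellOp s k l) := by
    intro i j k l
    have := congrFun h ![i, j, k, l]
    rw [localOp_seed_apply, Pi.smul_apply, seed_apply, smul_eq_mul] at this
    linear_combination 2 * this
  have pair : ∀ (a b : Fin 2 → Fin 2 → ℂ) (P Q : Fin 4 → Matrix (Fin 2) (Fin 2) ℂ),
      ∑ s, ((1 / 2) * ∑ i, ∑ j, a i j * P s i j) * z s * ((1 / 2) * ∑ k, ∑ l, b k l * Q s k l) =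
        (1 / 4) * ∑ i, ∑ j, ∑ k, ∑ l, a i j * b k l * ∑ s, z s * (P s i j * Q s k l) := by
    intro a b P Q
    simp only [Fin.sum_univ_four, Fin.sum_univ_two]
    ring
  have orth : ∀ s t, (1 / 2) * ∑ i, ∑ j, bellOp s i j * bellOp t i j = if s = t then 1 else 0 := by
    intro s t
    fin_cases s <;> fin_cases t <;> norm_num [bellOp, Fin.sum_univ_two]
  ext u v
  have h1 := pair (bellOp u) (bellOp v) (fun s => A 0 * bellOp s * (A 1)ᵀ)
    (fun s => A 2 * bellOp s * (A 3)ᵀ)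
  have h2 := pair (bellOp u) (bellOp v) bellOp bellOp
  simp only [orth] at h2
  simp only [key] at h1
  have h3 : (bellMatrix (A 0) (A 1) * Matrix.diagonal z * (bellMatrix (A 2) (A 3))ᵀ) u v =
      c * ∑ s, (if u = s then 1 else 0) * z s * (if v = s then 1 else 0) := by
    rw [h2, Matrix.mul_apply]
    simp only [Matrix.mul_diagonal, Matrix.transpose_apply, bellMatrix, Matrix.of_apply]
    rw [h1]
    simp only [Finset.mul_sum]
    refine Finset.sum_congr rfl fun i _ => Finset.sum_congr rfl fun j _ =>
      Finset.sum_congr rfl fun k _ => Finset.sum_congr rfl fun l _ =>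
      Finset.sum_congr rfl fun s _ => by ring
  rw [h3]
  by_cases huv : u = v
  · subst huv; simp
  · simp [huv]

/-- Eliminates `P` between the symmetry equation and its transpose. Since `D` commutes with the
involution `K`, `D * D` equals `D * K * D * K`, and the two copies of `K` can be replaced through
the invariance of the form. -/
theorem intertwine_sq {R : Type*} [CommRing R] {ι : Type*} [Fintype ι] [DecidableEq ι]
    {O P O' P' D K : Matrix ι ι R} {a b c : R} (hKK : K * K = 1) (hKD : K * D = D * K)
    (hO : O' * K * O = a • K) (hP : P' * K * P = b • K)
    (h : O * D * P' = c • D) (h' : P * D * O' = c • D) :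
    (a * b) • (O * (D * D)) = c ^ 2 • (D * D * O) := by
  have hDD : D * K * (D * K) = D * D := by
    rw [← hKD, mul_assoc, ← mul_assoc D, ← hKD, mul_assoc K D, ← mul_assoc K K, hKK, one_mul]
  calc (a * b) • (O * (D * D)) = (a * b) • (O * (D * K * (D * K))) := by rw [hDD]
    _ = O * D * (P' * K * P) * D * (O' * K * O) := by
      rw [hP, hO]
      simp only [Matrix.mul_smul, Matrix.smul_mul, smul_smul, mul_assoc]
    _ = (O * D * P') * K * (P * D * O') * K * O := by simp only [mul_assoc]
    _ = c ^ 2 • (D * K * (D * K) * O) := by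
      rw [h, h']
      simp only [Matrix.mul_smul, Matrix.smul_mul, smul_smul, mul_assoc, pow_two]
    _ = _ := by rw [hDD]

/-- A symmetry of a generic seed state acts diagonally in the Bell basis. -/
theorem IsGenericSeed.isDiag {z : Fin 4 → ℂ} (hz : IsGenericSeed z)
    {O P : Matrix (Fin 4) (Fin 4) ℂ} {a b c : ℂ} (ha : a ≠ 0) (hb : b ≠ 0)
    (hO : Oᵀ * bellForm * O = a • bellForm) (hP : Pᵀ * bellForm * P = b • bellForm)
    (h : O * Matrix.diagonal z * Pᵀ = c • Matrix.diagonal z) {s t : Fin 4} (hst : s ≠ t) :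
    O s t = 0 := by
  have hKK : bellForm * bellForm = 1 := by
    rw [bellForm, Matrix.diagonal_mul_diagonal, ← Matrix.diagonal_one]
    congr 1; funext i; fin_cases i <;> simp
  have hKT : bellFormᵀ = bellForm := Matrix.diagonal_transpose _
  have hDT : (Matrix.diagonal z)ᵀ = Matrix.diagonal z := Matrix.diagonal_transpose _
  have hKD : bellForm * Matrix.diagonal z = Matrix.diagonal z * bellForm := by
    rw [bellForm, Matrix.diagonal_mul_diagonal, Matrix.diagonal_mul_diagonal]
    congr 1; funext i; ring
  have hT : P * Matrix.diagonal z * Oᵀ = c • Matrix.diagonal z := by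
    have := congrArg Matrix.transpose h
    simpa [Matrix.transpose_mul, hDT, mul_assoc] using this
  have hcomm := intertwine_sq hKK hKD hO hP h hT
  have hent : ∀ i j, a * b * (O i j * z j ^ 2) = c ^ 2 * (z i ^ 2 * O i j) := by
    intro i j
    have := congrFun (congrFun hcomm i) j
    simp only [Matrix.diagonal_mul_diagonal, Matrix.mul_diagonal, Matrix.diagonal_mul,
      Matrix.smul_apply, smul_eq_mul] at this
    linear_combination this
  -- Scaling a nondegenerate form by `a ≠ 0` makes `O` invertible, so no row or column of `O`
  -- vanishes.
  have hleft : (a⁻¹ • (bellForm * Oᵀ * bellForm)) * O = 1 := by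
    rw [Matrix.smul_mul, show bellForm * Oᵀ * bellForm * O = bellForm * (Oᵀ * bellForm * O) by
      simp only [mul_assoc], hO,
      Matrix.mul_smul, hKK, smul_smul, inv_mul_cancel₀ ha, one_smul]
  have hright := mul_eq_one_comm.mp hleft
  have hcol : ∀ j, ∃ i, O i j ≠ 0 := by
    intro j
    by_contra! h0
    have := congrFun (congrFun hleft j) j
    rw [Matrix.mul_apply, Matrix.one_apply_eq] at this
    simp [h0] at this
  have hrow : ∀ i, ∃ j, O i j ≠ 0 := by
    intro i
    by_contra! h0
    have := congrFun (congrFun hright i) i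
    rw [Matrix.mul_apply, Matrix.one_apply_eq] at this
    simp [h0] at this
  have hq : ∀ i j, O i j ≠ 0 → c ^ 2 / (a * b) * z i ^ 2 = z j ^ 2 := by
    intro i j hij
    have := hent i j
    have h2 : O i j * (c ^ 2 * z i ^ 2) = O i j * (z j ^ 2 * (a * b)) := by
      linear_combination -this
    rw [div_mul_eq_mul_div, div_eq_iff (mul_ne_zero ha hb)]
    exact mul_left_cancel₀ hij h2
  -- A nonzero entry in each row and each column makes multiplication by this factor map the set of
  -- squares onto itself.
  have hq1 : c ^ 2 / (a * b) = 1 := by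
    by_contra hne
    refine hz.2 _ hne (Set.Subset.antisymm ?_ ?_)
    · rintro _ ⟨_, ⟨i, rfl⟩, rfl⟩
      obtain ⟨j, hj⟩ := hrow i
      exact ⟨j, (hq i j hj).symm⟩
    · rintro _ ⟨j, rfl⟩
      obtain ⟨i, hi⟩ := hcol j
      exact ⟨_, ⟨i, rfl⟩, hq i j hi⟩
  by_contra h0
  have := hq s t h0
  rw [hq1, one_mul, sq_eq_sq_iff_eq_or_eq_neg] at this
  exact this.elim (hz.1 s t hst).1 (hz.1 s t hst).2

theorem eq_sum_bellOp (A : Matrix (Fin 2) (Fin 2) ℂ) :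
    ∃ α : Fin 4 → ℂ, A = ∑ s : Fin 4, α s • bellOp s := by
  refine ⟨![(A 0 0 + A 1 1) / 2, (A 0 1 + A 1 0) / 2, (A 0 1 - A 1 0) / 2, (A 0 0 - A 1 1) / 2], ?_⟩
  ext i j
  fin_cases i <;> fin_cases j <;> simp [Fin.sum_univ_four, bellOp] <;> ring

/-- If `A ⊗ B` is diagonal in the Bell basis, then `A` and `B` are proportional to the same Pauli
matrix. -/
theorem exists_bellOp_of_isDiag {A B : Matrix (Fin 2) (Fin 2) ℂ} (hA : A ≠ 0) (hB : B ≠ 0)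
    (h : ∀ s t, s ≠ t → bellMatrix A B s t = 0) :
    ∃ (s : Fin 4) (a b : ℂ), A = a • bellOp s ∧ B = b • bellOp s := by
  obtain ⟨α, rfl⟩ := eq_sum_bellOp A
  obtain ⟨β, rfl⟩ := eq_sum_bellOp B
  -- The off-diagonal entries split into three groups of four signed sums of the products `α s * β
  -- t` with `s ≠ t`; each 4 × 4 sign system is inverted explicitly.
  have hαβ : ∀ s t, s ≠ t → α s * β t = 0 := by
    have h01 := h 0 1 (by decide)
    have h02 := h 0 2 (by decide)
    have h03 := h 0 3 (by decide)
    have h10 := h 1 0 (by decide)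
    have h12 := h 1 2 (by decide)
    have h13 := h 1 3 (by decide)
    have h20 := h 2 0 (by decide)
    have h21 := h 2 1 (by decide)
    have h23 := h 2 3 (by decide)
    have h30 := h 3 0 (by decide)
    have h31 := h 3 1 (by decide)
    have h32 := h 3 2 (by decide)
    simp only [bellMatrix, Matrix.of_apply, Matrix.mul_apply, Matrix.transpose_apply,
      Fin.sum_univ_two, Fin.sum_univ_four, Matrix.add_apply, Matrix.smul_apply, smul_eq_mul]
      at h01 h02 h03 h10 h12 h13 h20 h21 h23 h30 h31 h32
    simp [bellOp] at h01 h02 h03 h10 h12 h13 h20 h21 h23 h30 h31 h32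
    intro s t hst
    fin_cases s <;> fin_cases t <;> first | exact absurd rfl hst | skip
    · change α 0 * β 1 = 0
      linear_combination (h01 + h10 + h23 + h32) / 8
    · change α 0 * β 2 = 0
      linear_combination (h02 - h13 - h20 + h31) / 8
    · change α 0 * β 3 = 0
      linear_combination (h03 - h12 - h21 + h30) / 8
    · change α 1 * β 0 = 0
      linear_combination (h01 + h10 - h23 - h32) / 8
    · change α 1 * β 2 = 0
      linear_combination (-h03 + h12 - h21 + h30) / 8
    · change α 1 * β 3 = 0
      linear_combination (-h02 + h13 - h20 + h31) / 8
    · change α 2 * β 0 = 0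
      linear_combination (-h02 - h13 + h20 + h31) / 8
    · change α 2 * β 1 = 0
      linear_combination (-h03 - h12 + h21 + h30) / 8
    · change α 2 * β 3 = 0
      linear_combination (h01 - h10 + h23 - h32) / 8
    · change α 3 * β 0 = 0
      linear_combination (h03 + h12 + h21 + h30) / 8
    · change α 3 * β 1 = 0
      linear_combination (h02 + h13 + h20 + h31) / 8
    · change α 3 * β 2 = 0
      linear_combination (h01 - h10 - h23 + h32) / 8
  obtain ⟨s, hs⟩ : ∃ s, α s ≠ 0 := by
    by_contra! h0; exact hA (by simp [h0])
  have hβ : ∀ t, t ≠ s → β t = 0 := fun t ht =>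
    (mul_eq_zero.mp (hαβ s t ht.symm)).resolve_left hs
  have hβs : β s ≠ 0 := by
    intro h0
    refine hB (Finset.sum_eq_zero fun t _ => ?_)
    by_cases ht : t = s
    · rw [ht, h0, zero_smul]
    · rw [hβ t ht, zero_smul]
  have hα : ∀ t, t ≠ s → α t = 0 := fun t ht =>
    (mul_eq_zero.mp (hαβ t s ht)).resolve_right hβs
  refine ⟨s, α s, β s, ?_, ?_⟩
  · exact Finset.sum_eq_single s (fun t _ ht => by rw [hα t ht, zero_smul]) (by simp)
  · exact Finset.sum_eq_single s (fun t _ ht => by rw [hβ t ht, zero_smul]) (by simp)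

/-- The sign with which conjugation by `bellOp s` acts on `bellOp t`. -/
def bellSign (s t : Fin 4) : ℤ := if s = 0 ∨ t = 0 ∨ s = t then 1 else -1

theorem bellOp_conj (s t : Fin 4) :
    bellOp s * bellOp t * (bellOp s)ᵀ = (bellSign s t : ℂ) • bellOp t := by
  fin_cases s <;> fin_cases t <;> ext i j <;> fin_cases i <;> fin_cases j <;>
    simp [bellOp, bellSign, Matrix.mul_apply]

theorem bellMatrix_smul_bellOp (a b : ℂ) (s u : Fin 4) :
    bellMatrix (a • bellOp s) (b • bellOp s) u u = a * b * bellSign s u := by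
  rw [bellMatrix, Matrix.of_apply, Matrix.transpose_smul, Matrix.smul_mul, Matrix.smul_mul,
    Matrix.mul_smul, bellOp_conj]
  fin_cases u <;> norm_num [bellOp, Fin.sum_univ_two] <;> ring

/-- The product of the two sign characters is a nontrivial character, hence takes each value twice.
Two indices per value are needed because one seed parameter may vanish. -/
theorem exists_bellSign_mul {s t : Fin 4} (h : s ≠ t) :
    (∃ u v, u ≠ v ∧ bellSign s u * bellSign t u = 1 ∧ bellSign s v * bellSign t v = 1) ∧
      ∃ u v, u ≠ v ∧ bellSign s u * bellSign t u = -1 ∧ bellSign s v * bellSign t v = -1 := by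
  revert s t
  decide

/-- The local symmetries of a generic seed state are the four operators `W ⊗ W ⊗ W ⊗ W`. -/
theorem IsGenericSeed.symmetry {z : Fin 4 → ℂ} (hz : IsGenericSeed z)
    {A : Fin 4 → Matrix (Fin 2) (Fin 2) ℂ} (hA : ∀ k, (A k).det ≠ 0) {c : ℂ} (hc : c ≠ 0)
    (h : localOp A (seed z) = c • seed z) :
    ∃ (s : Fin 4) (a : Fin 4 → ℂ), ∀ k, A k = a k • bellOp s := by
  have h1 := bellMatrix_diagonal h
  have h2 : bellMatrix (A 2) (A 3) * Matrix.diagonal z * (bellMatrix (A 0) (A 1))ᵀ =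
      c • Matrix.diagonal z := by
    simpa [Matrix.transpose_mul, mul_assoc] using congrArg Matrix.transpose h1
  have hne : ∀ k, A k ≠ 0 := fun k h0 => hA k (by rw [h0, Matrix.det_zero])
  obtain ⟨s, a₀, a₁, h₀, h₁⟩ := exists_bellOp_of_isDiag (hne 0) (hne 1) fun s t hst =>
    hz.isDiag (mul_ne_zero (hA 0) (hA 1)) (mul_ne_zero (hA 2) (hA 3)) (bellMatrix_form _ _)
      (bellMatrix_form _ _) h1 hst
  obtain ⟨t, a₂, a₃, h₂, h₃⟩ := exists_bellOp_of_isDiag (hne 2) (hne 3) fun s t hst =>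
    hz.isDiag (mul_ne_zero (hA 2) (hA 3)) (mul_ne_zero (hA 0) (hA 1)) (bellMatrix_form _ _)
      (bellMatrix_form _ _) h2 hst
  have hst : s = t := by
    by_contra hst
    -- Different Pauli matrices on the two pairs would make `c` equal to both signs of `a₀ * a₁ * a₂
    -- * a₃`, hence zero.
    have hdiag : ∀ u, a₀ * a₁ * a₂ * a₃ * (bellSign s u * bellSign t u : ℤ) * z u = c * z u := by
      intro u
      have hd : ∀ s t, s ≠ t → bellMatrix (A 0) (A 1) s t = 0 := fun s t hst =>
        hz.isDiag (mul_ne_zero (hA 0) (hA 1)) (mul_ne_zero (hA 2) (hA 3)) (bellMatrix_form _ _)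
          (bellMatrix_form _ _) h1 hst
      have := congrFun (congrFun h1 u) u
      rw [Matrix.mul_apply, Finset.sum_eq_single u] at this
      · rw [Matrix.mul_diagonal, Matrix.transpose_apply, h₀, h₁, h₂, h₃, bellMatrix_smul_bellOp,
          bellMatrix_smul_bellOp, Matrix.smul_apply, Matrix.diagonal_apply_eq, smul_eq_mul] at this
        push_cast
        linear_combination this
      · intro v _ hv
        rw [Matrix.mul_diagonal, hd u v hv.symm, zero_mul, zero_mul]
      · simp
    have hval : ∀ (x : ℤ) (u v : Fin 4), u ≠ v → bellSign s u * bellSign t u = x →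
        bellSign s v * bellSign t v = x → a₀ * a₁ * a₂ * a₃ * (x : ℂ) = c := by
      intro x u v huv hu hv
      rcases hz.exists_ne_zero huv with h0 | h0
      · exact mul_right_cancel₀ h0 (hu ▸ hdiag u)
      · exact mul_right_cancel₀ h0 (hv ▸ hdiag v)
    obtain ⟨⟨u, v, huv, hu, hv⟩, u', v', huv', hu', hv'⟩ := exists_bellSign_mul hst
    have e1 := hval 1 u v huv hu hv
    have e2 := hval (-1) u' v' huv' hu' hv'
    push_cast at e1 e2
    exact hc (by linear_combination -(e1 + e2) / 2)
  subst hst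
  refine ⟨s, ![a₀, a₁, a₂, a₃], fun k => ?_⟩
  fin_cases k
  exacts [h₀, h₁, h₂, h₃]

end Stabilizer

/-! ### Gram operators along an LOCC protocol -/

section LOCC

theorem localOp_injective_of_left_inverse {n : ℕ} {d e : Fin n → ℕ}
    {A : (i : Fin n) → Matrix (Fin (e i)) (Fin (d i)) ℂ}
    {L : (i : Fin n) → Matrix (Fin (d i)) (Fin (e i)) ℂ} (hL : ∀ i, L i * A i = 1)
    {φ ψ : QState d} (h : localOp A φ = localOp A ψ) : φ = ψ := by
  have := congrArg (localOp L) h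
  simpa only [localOp_localOp, hL, localOp_one] using this

theorem GL_inv_mul_self (g : GL (Fin 2) ℂ) : (g⁻¹).val * g.val = 1 := by simp

theorem GL_mul_inv_self (g : GL (Fin 2) ℂ) : g.val * (g⁻¹).val = 1 := by simp

theorem GL_det_ne_zero (g : GL (Fin 2) ℂ) : g.val.det ≠ 0 :=
  ((Matrix.isUnit_iff_isUnit_det _).mp g.isUnit).ne_zero

theorem seedOrbit_ne_zero {z : Fin 4 → ℂ} (hz : IsGenericSeed z) (h : Fin 4 → GL (Fin 2) ℂ) :
    seedOrbit h z ≠ 0 := fun h0 =>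
  seed_ne_zero hz (localOp_injective_of_left_inverse (fun i => GL_inv_mul_self (h i))
    (h0.trans (localOp_zero_state _).symm))

/-- Local operators that map a four-qubit state into the orbit of a generic seed state are
invertible. -/
theorem det_ne_zero_of_localOp_eq {z : Fin 4 → ℂ} (hz : IsGenericSeed z)
    (h : Fin 4 → GL (Fin 2) ℂ) {B : Fin 4 → Matrix (Fin 2) (Fin 2) ℂ} {φ : QubitState 4} {c : ℂ}
    (hc : c ≠ 0) (hB : localOp B φ = c • seedOrbit h z) (p : Fin 4) : (B p).det ≠ 0 := by
  intro h0
  obtain ⟨v, hv, hvB⟩ := Matrix.exists_vecMul_eq_zero_iff.mpr h0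
  -- All rows of `R` are a left null vector of `B p`, so `R` at `p` would annihilate a state of full
  -- local rank.
  let R : Matrix (Fin 2) (Fin 2) ℂ := Matrix.of fun _ j => v j
  have hR : R * B p = 0 := by
    ext i j
    exact congrFun hvB j
  let U : Fin 4 → Matrix (Fin 2) (Fin 2) ℂ := Function.update (fun _ => 1) p R
  have h1 : localOp U (localOp B φ) = 0 := by
    rw [localOp_localOp]
    exact localOp_eq_zero_of_eq_zero _ p (by simpa [U] using hR) _
  rw [hB, localOp_smul_state, seedOrbit, localOp_localOp] at h1
  have h2 := (smul_eq_zero.mp h1).resolve_left hc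
  have h3 := eq_zero_of_localOp_seed hz (d := fun _ => 2) _ p (fun i => ((h i)⁻¹).val)
    (fun i hi => by simp [U, Function.update_of_ne hi]) h2
  have h4 : R = 0 := by
    rw [← mul_one R, ← GL_mul_inv_self (h p), ← mul_assoc]
    simp only [U, Function.update_self] at h3
    rw [h3, zero_mul]
  exact hv (funext fun j => congrFun (congrFun h4 0) j)

/-- Two points in the local orbit of a generic seed state are proportional only if the local
operators agree up to a common Pauli matrix. -/
theorem IsGenericSeed.eq_mul_bellOp {z : Fin 4 → ℂ} (hz : IsGenericSeed z)
    (h : Fin 4 → GL (Fin 2) ℂ) {B : Fin 4 → Matrix (Fin 2) (Fin 2) ℂ} {c : ℂ} (hc : c ≠ 0)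
    (hB : localOp B (seed z) = c • seedOrbit h z) :
    ∃ (s : Fin 4) (a : Fin 4 → ℂ), ∀ k, B k = a k • ((h k).val * bellOp s) := by
  have h1 : localOp (fun k => ((h k)⁻¹).val * B k) (seed z) = c • seed z := by
    rw [← localOp_localOp, hB, localOp_smul_state, seedOrbit, localOp_localOp]
    simp only [GL_inv_mul_self]
    rw [localOp_one (d := fun _ => 2)]
  obtain ⟨s, a, hs⟩ := hz.symmetry (fun k => by
    rw [Matrix.det_mul]
    exact mul_ne_zero (GL_det_ne_zero _) (det_ne_zero_of_localOp_eq hz h hc hB k)) hc h1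
  refine ⟨s, a, fun k => ?_⟩
  rw [← Matrix.mul_smul, ← hs k, ← mul_assoc, GL_mul_inv_self, one_mul]

/-- The Gram operator of `B` is a convex combination, up to normalisation, of the Gram operators of
`h W ⊗ h W ⊗ h W ⊗ h W`; equality is tested against product observables. -/
def IsPauliMixture (h : Fin 4 → Matrix (Fin 2) (Fin 2) ℂ)
    (G : Fin 4 → Matrix (Fin 2) (Fin 2) ℂ) : Prop :=
  ∃ p : Fin 4 → ℝ, (∀ s, 0 ≤ p s) ∧ ∀ W : Fin 4 → Matrix (Fin 2) (Fin 2) ℂ,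
    ∏ k, (W k * G k).trace =
      ∑ s, (p s : ℂ) * ∏ k, (W k * ((bellOp s)ᵀ * ((h k)ᴴ * h k) * bellOp s)).trace

theorem trace_gram_smul_mul_bellOp (W M : Matrix (Fin 2) (Fin 2) ℂ) (a : ℂ) (s : Fin 4) :
    (W * ((a • (M * bellOp s))ᴴ * (a • (M * bellOp s)))).trace =
      (‖a‖ : ℂ) ^ 2 * (W * ((bellOp s)ᵀ * (Mᴴ * M) * bellOp s)).trace := by
  have ha : star a * a = (‖a‖ : ℂ) ^ 2 := by
    rw [Complex.star_def, ← Complex.normSq_eq_conj_mul_self, Complex.normSq_eq_norm_sq]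
    push_cast
    rfl
  rw [Matrix.conjTranspose_smul, Matrix.smul_mul, Matrix.mul_smul _ a, smul_smul, Matrix.mul_smul,
    Matrix.trace_smul, smul_eq_mul, ha, Matrix.conjTranspose_mul, bellOp_conjTranspose]
  simp only [mul_assoc]

/-- Induction on the protocol. At a leaf the symmetries of the seed determine `B`. In a round the
isometries preserve the Gram factors away from `p`, and completeness of the measurement sums the
branches to the Gram operator of `B`. Left inverses are part of the induction because local
dimensions may grow and branches of probability zero have to be controlled. -/
theorem LOCCReaches.isPauliMixture {z : Fin 4 → ℂ} (hz : IsGenericSeed z)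
    (h : Fin 4 → GL (Fin 2) ℂ) {d : Fin 4 → ℕ} {φ : QState d}
    (hφ : LOCCReaches (seedOrbit h z) φ) (hne : φ ≠ 0)
    (B : (i : Fin 4) → Matrix (Fin (d i)) (Fin 2) ℂ) (hB : φ = localOp B (seed z)) :
    (∃ L : (i : Fin 4) → Matrix (Fin 2) (Fin (d i)) ℂ, ∀ i, L i * B i = 1) ∧
      IsPauliMixture (fun k => (h k).val) (fun k => (B k)ᴴ * B k) := by
  induction hφ with
  | done c =>
    have hc : c ≠ 0 := by
      rintro rfl
      exact hne (zero_smul _ _)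
    have hdet := det_ne_zero_of_localOp_eq hz h hc hB.symm
    refine ⟨⟨fun i => (B i)⁻¹, fun i =>
      Matrix.nonsing_inv_mul _ (isUnit_iff_ne_zero.mpr (hdet i))⟩, ?_⟩
    obtain ⟨s, a, hs⟩ := hz.eq_mul_bellOp h hc hB.symm
    refine ⟨fun t => if t = s then ∏ k, ‖a k‖ ^ 2 else 0, fun t => ?_, fun W => ?_⟩
    · dsimp only
      split_ifs <;> positivity
    · dsimp only
      rw [Finset.sum_eq_single s (fun t _ ht => by simp [ht]) (by simp), if_pos rfl]
      push_cast
      rw [← Finset.prod_mul_distrib]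
      refine Finset.prod_congr rfl fun k _ => ?_
      rw [hs k]
      exact trace_gram_smul_mul_bellOp _ _ _ _
  | @round d φ p m e A measurement isometries _ ih =>
    have hAB : ∀ k, localOp (A k) φ = localOp (fun i => A k i * B i) (seed z) := fun k => by
      rw [hB, localOp_localOp]
    have inv : ∃ L : (i : Fin 4) → Matrix (Fin 2) (Fin (d i)) ℂ, ∀ i, L i * B i = 1 := by
      obtain ⟨k, hk⟩ := exists_localOp_ne_zero measurement isometries hne
      obtain ⟨⟨L, hL⟩, -⟩ := ih k hk _ (hAB k)
      exact ⟨fun i => L i * A k i, fun i => by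
        rw [← hL i, Matrix.mul_assoc]⟩
    refine ⟨inv, ?_⟩
    obtain ⟨L, hL⟩ := inv
    have hmix : ∀ k, ∃ q : Fin 4 → ℝ, (∀ s, 0 ≤ q s) ∧
        ∀ W : Fin 4 → Matrix (Fin 2) (Fin 2) ℂ,
        ∏ j, (W j * ((A k j * B j)ᴴ * (A k j * B j))).trace = ∑ s, (q s : ℂ) *
          ∏ j, (W j * ((bellOp s)ᵀ * ((h j).valᴴ * (h j).val) * bellOp s)).trace := by
      intro k
      -- In a branch of probability zero the factor at `p` vanishes, so its Gram operator is zero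
      -- and gets zero weights.
      by_cases hk : localOp (A k) φ = 0
      · rw [hAB k] at hk
        have h0 := eq_zero_of_localOp_seed hz _ p (fun i => L i * (A k i)ᴴ) (fun i hi => by
          rw [Matrix.mul_assoc, ← Matrix.mul_assoc (A k i)ᴴ, isometries k i hi, Matrix.one_mul,
            hL i]) hk
        refine ⟨0, fun _ => le_rfl, fun W => ?_⟩
        rw [Finset.prod_eq_zero (Finset.mem_univ p) (by rw [h0]; simp)]
        simp
      · exact (ih k hk _ (hAB k)).2
    choose q hq0 hq using hmix
    refine ⟨fun s => ∑ k, q k s, fun s => Finset.sum_nonneg fun k _ => hq0 k s, fun W => ?_⟩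
    push_cast
    simp only [Finset.sum_mul]
    rw [Finset.sum_comm]
    simp only [← hq]
    have hiso : ∀ k, ∏ j, (W j * ((A k j * B j)ᴴ * (A k j * B j))).trace =
        (W p * ((B p)ᴴ * ((A k p)ᴴ * A k p) * B p)).trace *
          ∏ j ∈ Finset.univ.erase p, (W j * ((B j)ᴴ * B j)).trace := by
      intro k
      rw [← Finset.mul_prod_erase _ _ (Finset.mem_univ p)]
      congr 1
      · rw [Matrix.conjTranspose_mul]
        simp only [Matrix.mul_assoc]
      · refine Finset.prod_congr rfl fun j hj => ?_
        rw [Matrix.conjTranspose_mul, Matrix.mul_assoc (B j)ᴴ, ← Matrix.mul_assoc (A k j)ᴴ,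
          isometries k j (Finset.ne_of_mem_erase hj), Matrix.one_mul]
    simp only [hiso]
    rw [← Finset.sum_mul, ← Matrix.trace_sum, ← Matrix.mul_sum, ← Matrix.sum_mul,
      ← Matrix.mul_sum, measurement, Matrix.mul_one]
    exact (Finset.mul_prod_erase _ _ (Finset.mem_univ p)).symm

/-- A deterministic LOCC protocol has a branch of nonzero probability. -/
theorem LOCCReaches.exists_branch {n : ℕ} {t d : Fin n → ℕ} {ψ : QState t} {φ : QState d}
    (h : LOCCReaches ψ φ) (hne : φ ≠ 0) :
    ∃ (A : (i : Fin n) → Matrix (Fin (t i)) (Fin (d i)) ℂ) (c : ℂ), c ≠ 0 ∧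
      localOp A φ = c • ψ := by
  induction h with
  | done c =>
    refine ⟨fun i => 1, c, fun h0 => hne (by rw [h0, zero_smul]), localOp_one _⟩
  | round φ p m e A measurement isometries _ ih =>
    obtain ⟨k, hk⟩ := exists_localOp_ne_zero measurement isometries hne
    obtain ⟨C, c, hc, hC⟩ := ih k hk
    exact ⟨fun i => C i * A k i, c, hc, by rw [← localOp_localOp, hC]⟩

/-- A qubit state from which a point in the orbit of a generic seed state can be reached lies in
this orbit. -/
theorem LOCCReaches.exists_eq_localOp_seed {z : Fin 4 → ℂ} (hz : IsGenericSeed z)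
    (h : Fin 4 → GL (Fin 2) ℂ) {φ : QubitState 4} (hφ : LOCCReaches (seedOrbit h z) φ)
    (hne : φ ≠ 0) : ∃ B : Fin 4 → Matrix (Fin 2) (Fin 2) ℂ, φ = localOp B (seed z) := by
  obtain ⟨A, c, hc, hA⟩ := hφ.exists_branch hne
  have hdet := det_ne_zero_of_localOp_eq hz h hc hA
  have h1 : φ = c • localOp (fun i => (A i)⁻¹ * (h i).val) (seed z) := by
    rw [← localOp_localOp, ← seedOrbit, ← localOp_smul_state, ← hA, localOp_localOp]
    simp only [fun i => Matrix.nonsing_inv_mul (A i) (isUnit_iff_ne_zero.mpr (hdet i))]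
    exact (localOp_one φ).symm
  -- The global scalar is absorbed into the operator of party 0.
  refine ⟨fun i => (if i = 0 then c else 1 : ℂ) • ((A i)⁻¹ * (h i).val), ?_⟩
  rw [localOp_smul_op (d := fun _ => 2) (e := fun _ => 2)]
  simpa using h1

end LOCC

/-! ### Bloch vectors of Gram matrices -/

section Bloch

/-- The matrices `1, X, Y, Z`. -/
noncomputable def sigma : Fin 4 → Matrix (Fin 2) (Fin 2) ℂ :=
  ![1, pauli 0, pauli 1, pauli 2]

theorem sigma_zero : sigma 0 = 1 := rfl

theorem sigma_succ (w : Fin 3) : sigma w.succ = pauli w := by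
  fin_cases w <;> rfl

theorem bellOp_conj_sigma (s a : Fin 4) :
    bellOp s * sigma a * (bellOp s)ᵀ = (bellSign s a : ℂ) • sigma a := by
  fin_cases s <;> fin_cases a <;> ext i j <;> fin_cases i <;> fin_cases j <;>
    simp [bellOp, bellSign, sigma, pauli, Matrix.mul_apply]

/-- The Pauli coefficients of the Gram matrix `gᴴ g`. -/
noncomputable def gramCoeff (g : Matrix (Fin 2) (Fin 2) ℂ) (a : Fin 4) : ℝ :=
  (sigma a * (gᴴ * g)).trace.re

theorem sigma_conjTranspose (a : Fin 4) : (sigma a)ᴴ = sigma a := by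
  fin_cases a <;> ext i j <;> fin_cases i <;> fin_cases j <;> simp [sigma, pauli]

/-- Both factors are Hermitian, so the trace is real and taking the real part loses nothing. -/
theorem coe_gramCoeff (g : Matrix (Fin 2) (Fin 2) ℂ) (a : Fin 4) :
    (gramCoeff g a : ℂ) = (sigma a * (gᴴ * g)).trace := by
  apply Complex.conj_eq_iff_re.mp
  rw [← Complex.star_def, ← Matrix.trace_conjTranspose, Matrix.conjTranspose_mul,
    sigma_conjTranspose, Matrix.conjTranspose_mul, Matrix.conjTranspose_conjTranspose,
    Matrix.trace_mul_comm]

theorem trace_sigma_zero (G : Matrix (Fin 2) (Fin 2) ℂ) :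
    (sigma 0 * G).trace = G 0 0 + G 1 1 := by
  simp [sigma, Matrix.trace_fin_two]

theorem trace_sigma_one (G : Matrix (Fin 2) (Fin 2) ℂ) :
    (sigma 1 * G).trace = G 1 0 + G 0 1 := by
  simp only [Matrix.trace_fin_two, Matrix.mul_apply, Fin.sum_univ_two]
  simp [sigma, pauli]

theorem trace_sigma_two (G : Matrix (Fin 2) (Fin 2) ℂ) :
    (sigma 2 * G).trace = Complex.I * (G 0 1 - G 1 0) := by
  simp only [Matrix.trace_fin_two, Matrix.mul_apply, Fin.sum_univ_two]
  simp [sigma, pauli]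
  ring

theorem trace_sigma_three (G : Matrix (Fin 2) (Fin 2) ℂ) :
    (sigma 3 * G).trace = G 0 0 - G 1 1 := by
  simp only [Matrix.trace_fin_two, Matrix.mul_apply, Fin.sum_univ_two]
  simp [sigma, pauli]
  ring

theorem eq_smul_of_trace_sigma {G K : Matrix (Fin 2) (Fin 2) ℂ} {r : ℂ}
    (h : ∀ a, (sigma a * G).trace = r * (sigma a * K).trace) : G = r • K := by
  obtain ⟨h0, h1, h2, h3⟩ := And.intro (h 0) (And.intro (h 1) (And.intro (h 2) (h 3)))
  simp only [trace_sigma_zero, trace_sigma_one, trace_sigma_two, trace_sigma_three] at h0 h1 h2 h3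
  have h2' : G 0 1 - G 1 0 = r * (K 0 1 - K 1 0) :=
    mul_left_cancel₀ Complex.I_ne_zero (by linear_combination h2)
  ext i j
  fin_cases i <;> fin_cases j <;> simp
  · linear_combination (h0 + h3) / 2
  · linear_combination (h1 + h2') / 2
  · linear_combination (h1 - h2') / 2
  · linear_combination (h0 - h3) / 2

/-- The determinant is the Minkowski form in Pauli coordinates. For invertible `g` the Bloch vector
thus lies strictly inside the ball. -/
theorem gramCoeff_sq_sub (g : Matrix (Fin 2) (Fin 2) ℂ) :
    gramCoeff g 0 ^ 2 - gramCoeff g 1 ^ 2 - gramCoeff g 2 ^ 2 - gramCoeff g 3 ^ 2 =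
      4 * ‖g.det‖ ^ 2 := by
  have key : ∀ G : Matrix (Fin 2) (Fin 2) ℂ, (sigma 0 * G).trace ^ 2 - (sigma 1 * G).trace ^ 2 -
      (sigma 2 * G).trace ^ 2 - (sigma 3 * G).trace ^ 2 = 4 * G.det := by
    intro G
    rw [trace_sigma_zero, trace_sigma_one, trace_sigma_two, trace_sigma_three,
      Matrix.det_fin_two]
    linear_combination (-(G 0 1 - G 1 0) ^ 2) * Complex.I_sq
  have := key (gᴴ * g)
  rw [Matrix.det_mul, Matrix.det_conjTranspose, Complex.star_def,
    ← Complex.normSq_eq_conj_mul_self, Complex.normSq_eq_norm_sq] at this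
  simp only [← coe_gramCoeff] at this
  exact_mod_cast this

theorem gramCoeff_zero_nonneg (g : Matrix (Fin 2) (Fin 2) ℂ) : 0 ≤ gramCoeff g 0 := by
  simp [gramCoeff, sigma, Matrix.trace_fin_two, Matrix.mul_apply]
  nlinarith [mul_self_nonneg (g 0 0).re, mul_self_nonneg (g 0 0).im, mul_self_nonneg (g 0 1).re,
    mul_self_nonneg (g 0 1).im, mul_self_nonneg (g 1 0).re, mul_self_nonneg (g 1 0).im,
    mul_self_nonneg (g 1 1).re, mul_self_nonneg (g 1 1).im]

theorem gramCoeff_zero_pos {g : Matrix (Fin 2) (Fin 2) ℂ} (hg : g.det ≠ 0) :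
    0 < gramCoeff g 0 := by
  refine lt_of_le_of_ne (gramCoeff_zero_nonneg g) fun h => ?_
  have h1 := gramCoeff_sq_sub g
  have h2 : 0 < ‖g.det‖ := norm_pos_iff.mpr hg
  rw [← h] at h1
  nlinarith [sq_nonneg (gramCoeff g 1), sq_nonneg (gramCoeff g 2), sq_nonneg (gramCoeff g 3)]

theorem sq_gramCoeff_lt {g : Matrix (Fin 2) (Fin 2) ℂ} (hg : g.det ≠ 0) (w : Fin 3) :
    gramCoeff g w.succ ^ 2 < gramCoeff g 0 ^ 2 := by
  have h1 := gramCoeff_sq_sub g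
  have h2 : 0 < ‖g.det‖ := norm_pos_iff.mpr hg
  have h3 := sq_nonneg (gramCoeff g 1)
  have h4 := sq_nonneg (gramCoeff g 2)
  have h5 := sq_nonneg (gramCoeff g 3)
  fin_cases w
  · change gramCoeff g 1 ^ 2 < _
    nlinarith
  · change gramCoeff g 2 ^ 2 < _
    nlinarith
  · change gramCoeff g 3 ^ 2 < _
    nlinarith

theorem gramCoeff_unitary_mul (u : Matrix.unitaryGroup (Fin 2) ℂ) (g : Matrix (Fin 2) (Fin 2) ℂ)
    (a : Fin 4) : gramCoeff (u.val * g) a = gramCoeff g a := by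
  have hu : (u.val)ᴴ * u.val = 1 := Unitary.coe_star_mul_self u
  rw [gramCoeff, Matrix.conjTranspose_mul, mul_assoc, ← mul_assoc (u.val)ᴴ, hu, one_mul, gramCoeff]

theorem trace_sigma_bellOp (s a : Fin 4) (M : Matrix (Fin 2) (Fin 2) ℂ) :
    (sigma a * ((bellOp s)ᵀ * M * bellOp s)).trace = bellSign s a * (sigma a * M).trace := by
  rw [← mul_assoc, ← mul_assoc, Matrix.trace_mul_comm, ← mul_assoc, ← mul_assoc,
    bellOp_conj_sigma, Matrix.smul_mul, Matrix.trace_smul, smul_eq_mul]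

theorem gramCoeff_mul_bellOp (g : Matrix (Fin 2) (Fin 2) ℂ) (s a : Fin 4) :
    gramCoeff (g * bellOp s) a = bellSign s a * gramCoeff g a := by
  have : (gramCoeff (g * bellOp s) a : ℂ) = bellSign s a * gramCoeff g a := by
    rw [coe_gramCoeff, coe_gramCoeff, ← trace_sigma_bellOp, Matrix.conjTranspose_mul,
      bellOp_conjTranspose]
    simp only [mul_assoc]
  exact_mod_cast this

theorem gramCoeff_smul (c : ℂ) (g : Matrix (Fin 2) (Fin 2) ℂ) (a : Fin 4) :
    gramCoeff (c • g) a = ‖c‖ ^ 2 * gramCoeff g a := by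
  have : (gramCoeff (c • g) a : ℂ) = ‖c‖ ^ 2 * gramCoeff g a := by
    have hc : star c * c = (‖c‖ : ℂ) ^ 2 := by
      rw [Complex.star_def, ← Complex.normSq_eq_conj_mul_self, Complex.normSq_eq_norm_sq]
      push_cast
      rfl
    rw [coe_gramCoeff, coe_gramCoeff, Matrix.conjTranspose_smul, Matrix.smul_mul,
      Matrix.mul_smul _ c, smul_smul, Matrix.mul_smul, Matrix.trace_smul, smul_eq_mul, hc]
  exact_mod_cast this

/-- Matrices with proportional Gram matrices agree up to a unitary on the left. -/
theorem exists_unitary_of_gram {A B : Matrix (Fin 2) (Fin 2) ℂ} (hB : B.det ≠ 0) {r : ℝ}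
    (hr : 0 < r) (hG : Aᴴ * A = (r : ℂ) • (Bᴴ * B)) :
    ∃ (u : Matrix.unitaryGroup (Fin 2) ℂ) (c : ℂ), c ≠ 0 ∧ A = c • (u.val * B) := by
  have hBu : IsUnit B.det := isUnit_iff_ne_zero.mpr hB
  set c : ℂ := (Real.sqrt r : ℂ) with hc
  have hc0 : c ≠ 0 := by
    rw [hc]; exact_mod_cast (Real.sqrt_pos.mpr hr).ne'
  have hcc : c * c = r := by
    rw [hc, ← Complex.ofReal_mul, Real.mul_self_sqrt hr.le]
  have hcs : star c = c := Complex.conj_ofReal _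
  have hU : (c⁻¹ • (A * B⁻¹))ᴴ * (c⁻¹ • (A * B⁻¹)) = 1 := by
    have h1 : (A * B⁻¹)ᴴ * (A * B⁻¹) = (c * c) • 1 := by
      calc (A * B⁻¹)ᴴ * (A * B⁻¹) = (B⁻¹)ᴴ * (Aᴴ * A) * B⁻¹ := by
            rw [Matrix.conjTranspose_mul]; simp only [mul_assoc]
        _ = (c * c) • ((B * B⁻¹)ᴴ * (B * B⁻¹)) := by
            rw [hG, ← hcc, Matrix.mul_smul, Matrix.smul_mul, Matrix.conjTranspose_mul]
            simp only [mul_assoc]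
        _ = _ := by rw [Matrix.mul_nonsing_inv _ hBu, Matrix.conjTranspose_one, mul_one]
    rw [Matrix.conjTranspose_smul, Matrix.smul_mul, Matrix.mul_smul _ c⁻¹, h1, smul_smul, smul_smul,
      star_inv₀, hcs, show c⁻¹ * c⁻¹ * (c * c) = 1 by field_simp, one_smul]
  refine ⟨⟨_, Matrix.mem_unitaryGroup_iff'.mpr hU⟩, c, hc0, ?_⟩
  rw [Matrix.smul_mul, smul_smul, mul_inv_cancel₀ hc0, one_smul, mul_assoc,
    Matrix.nonsing_inv_mul _ hBu, mul_one]

theorem exists_unitary_of_gramCoeff {A B : Matrix (Fin 2) (Fin 2) ℂ} (hA : A.det ≠ 0)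
    (hB : B.det ≠ 0) {r : ℝ} (h : ∀ a, gramCoeff A a = r * gramCoeff B a) :
    ∃ (u : Matrix.unitaryGroup (Fin 2) ℂ) (c : ℂ), c ≠ 0 ∧ A = c • (u.val * B) := by
  have hr : 0 < r := by
    have h1 := gramCoeff_zero_pos hA
    rw [h 0] at h1
    exact (pos_iff_pos_of_mul_pos h1).mpr (gramCoeff_zero_pos hB)
  exact exists_unitary_of_gram hB hr (eq_smul_of_trace_sigma fun a => by
    rw [← coe_gramCoeff, ← coe_gramCoeff, h a]
    push_cast
    rfl)

/-- The span of `1` and a Pauli matrix is closed under products and adjoints, so it contains the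
Gram matrix. -/
theorem gramCoeff_span (w v : Fin 3) (hv : v ≠ w) (a b : ℂ) :
    gramCoeff (a • 1 + b • pauli w) v.succ = 0 := by
  simp only [gramCoeff, sigma_succ]
  simp only [Matrix.trace_fin_two, Matrix.mul_apply, Fin.sum_univ_two,
    Matrix.conjTranspose_apply, Matrix.add_apply, Matrix.smul_apply]
  fin_cases w <;> fin_cases v <;> first | exact absurd rfl hv | simp [pauli] ; try ring

theorem gramCoeff_one_add (w : Fin 3) (t : ℝ) :
    gramCoeff (1 + (t : ℂ) • pauli w) 0 = 2 * (1 + t ^ 2) ∧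
      gramCoeff (1 + (t : ℂ) • pauli w) w.succ = 4 * t := by
  simp only [gramCoeff, sigma_succ, sigma_zero]
  simp only [Matrix.trace_fin_two, Matrix.mul_apply, Fin.sum_univ_two,
    Matrix.conjTranspose_apply, Matrix.add_apply, Matrix.smul_apply]
  fin_cases w <;> simp [pauli] <;> constructor <;> ring

theorem det_one_add (w : Fin 3) (t : ℝ) :
    (1 + (t : ℂ) • pauli w).det = ((1 - t ^ 2 : ℝ) : ℂ) := by
  fin_cases w <;> simp [pauli, Matrix.det_fin_two]
  · ring
  · linear_combination (t : ℂ) ^ 2 * Complex.I_sq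
  · ring

theorem gramCoeff_eq_zero_of_isPauliForm {w : Fin 3} {g : GL (Fin 2) ℂ} (h : IsPauliForm w g)
    {v : Fin 3} (hv : v ≠ w) : gramCoeff g.val v.succ = 0 := by
  obtain ⟨u, hu⟩ := h
  obtain ⟨a, b, hab⟩ := Submodule.mem_span_pair.mp hu
  rw [← gramCoeff_unitary_mul u, ← hab, gramCoeff_span w v hv]

/-- A matrix in the real span of `1` and a Pauli matrix with prescribed Gram matrix. -/
theorem exists_gramCoeff_one_add (w : Fin 3) {x y : ℝ} (hx : 0 < x) (hxy : y ^ 2 < x ^ 2) :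
    ∃ r t : ℝ, 0 < r ∧ (1 + (t : ℂ) • pauli w).det ≠ 0 ∧
      r * gramCoeff (1 + (t : ℂ) • pauli w) 0 = x ∧
      r * gramCoeff (1 + (t : ℂ) • pauli w) w.succ = y ∧
      ∀ v, v ≠ w → gramCoeff (1 + (t : ℂ) • pauli w) v.succ = 0 := by
  have hD : 0 < x ^ 2 - y ^ 2 := by linarith
  set q := Real.sqrt (x ^ 2 - y ^ 2) with hq
  have hq0 : 0 < q := Real.sqrt_pos.mpr hD
  have hqq : q ^ 2 = x ^ 2 - y ^ 2 := Real.sq_sqrt hD.le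
  have hxq : x + q ≠ 0 := by positivity
  have ht1 : 1 + (y / (x + q)) ^ 2 = 2 * x / (x + q) := by
    field_simp
    linear_combination hqq
  have ht2 : 1 - (y / (x + q)) ^ 2 = 2 * q / (x + q) := by
    field_simp
    linear_combination -hqq
  -- The Bloch component requires `2 * t / (1 + t ^ 2) = y / x`; `t = y / (x + q)` is the root in
  -- `(-1, 1)`, and `r` then fixes the trace.
  obtain ⟨e0, e1⟩ := gramCoeff_one_add w (y / (x + q))
  refine ⟨(x + q) / 4, y / (x + q), by positivity, ?_, ?_, ?_, fun v hv => ?_⟩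
  · rw [det_one_add, ht2]
    exact_mod_cast (by positivity : (0 : ℝ) < 2 * q / (x + q)).ne'
  · rw [e0, ht1]
    field_simp
    norm_num
  · rw [e1]
    field_simp
  · simpa using gramCoeff_span w v hv 1 ((y / (x + q) : ℝ) : ℂ)

theorem exists_one_add_of_gramCoeff {w : Fin 3} {g : GL (Fin 2) ℂ}
    (h : ∀ v, v ≠ w → gramCoeff g.val v.succ = 0) :
    ∃ (u : Matrix.unitaryGroup (Fin 2) ℂ) (c : ℂ) (t : ℝ), c ≠ 0 ∧
      g.val = c • (u.val * (1 + (t : ℂ) • pauli w)) := by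
  have hg := GL_det_ne_zero g
  obtain ⟨r, t, -, hdet, h0, h1, h2⟩ :=
    exists_gramCoeff_one_add w (gramCoeff_zero_pos hg) (sq_gramCoeff_lt hg w)
  obtain ⟨u, c, hc, hu⟩ := exists_unitary_of_gramCoeff (r := r) hg hdet (by
    intro a
    refine Fin.cases h0.symm (fun v => ?_) a
    by_cases hv : v = w
    · rw [hv, h1]
    · rw [h v hv, h2 v hv, mul_zero])
  exact ⟨u, c, t, hc, hu⟩

theorem isPauliForm_of_eq {w : Fin 3} {g : GL (Fin 2) ℂ} {u : Matrix.unitaryGroup (Fin 2) ℂ}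
    {c t : ℂ} (h : g.val = c • (u.val * (1 + t • pauli w))) : IsPauliForm w g := by
  refine ⟨star u, ?_⟩
  have hu : (star u : Matrix.unitaryGroup (Fin 2) ℂ).val * u.val = 1 := Unitary.coe_star_mul_self u
  rw [h, Matrix.mul_smul, ← mul_assoc, hu, one_mul]
  exact Submodule.mem_span_pair.mpr ⟨c, c * t, by rw [smul_add, smul_smul]⟩

/-- Being of the form `h_w` means that the Bloch vector of the Gram matrix points along `w`. -/
theorem isPauliForm_iff {w : Fin 3} {g : GL (Fin 2) ℂ} :
    IsPauliForm w g ↔ ∀ v, v ≠ w → gramCoeff g.val v.succ = 0 := by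
  refine ⟨fun h v hv => gramCoeff_eq_zero_of_isPauliForm h hv, fun h => ?_⟩
  obtain ⟨u, c, t, -, hu⟩ := exists_one_add_of_gramCoeff h
  exact isPauliForm_of_eq hu

theorem IsTrivialForm.isPauliForm {g : GL (Fin 2) ℂ} (h : IsTrivialForm g) (w : Fin 3) :
    IsPauliForm w g := by
  obtain ⟨u, c, hu⟩ := h
  exact ⟨u, hu ▸ Submodule.smul_mem _ _ (Submodule.subset_span (by simp))⟩

/-- A Bloch vector on two different axes is zero, so the Gram matrix is a multiple of the identity.
-/
theorem isTrivialForm_of_isPauliForm {g : GL (Fin 2) ℂ} {w v : Fin 3} (hwv : w ≠ v)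
    (hw : IsPauliForm w g) (hv : IsPauliForm v g) : IsTrivialForm g := by
  rw [isPauliForm_iff] at hw hv
  obtain ⟨u, c, hc, hu⟩ := exists_unitary_of_gramCoeff (A := g.val) (B := 1)
    (r := gramCoeff g.val 0 / 2) (GL_det_ne_zero g) (by simp) (by
      have h0 : gramCoeff 1 0 = 2 := by
        simp [gramCoeff, sigma]
      have h1 : ∀ a : Fin 3, gramCoeff 1 a.succ = 0 := fun a => by
        rw [gramCoeff, sigma_succ]
        fin_cases a <;> simp [pauli, Matrix.trace_fin_two]
      intro a
      refine Fin.cases ?_ (fun b => ?_) a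
      · rw [h0]; ring
      · rw [h1, mul_zero]
        by_cases hb : b = w
        · exact hv b (by rw [hb]; exact hwv)
        · exact hw b hb)
  refine ⟨star u, c, ?_⟩
  have huu : (star u : Matrix.unitaryGroup (Fin 2) ℂ).val * u.val = 1 :=
    Unitary.coe_star_mul_self u
  rw [hu, mul_one, Matrix.mul_smul, huu]

end Bloch

/-! ### Product vectors under mixtures of Pauli conjugations -/

section Mixture

theorem prod_ite_three {f : Fin 4 → Fin 4 → ℝ} (hf : ∀ k, f k 0 = 1) {i j k : Fin 4} (hij : i ≠ j)
    (hik : i ≠ k) (hjk : j ≠ k) (a b c : Fin 4) :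
    ∏ m, f m (if m = i then a else if m = j then b else if m = k then c else 0) =
      f i a * f j b * f k c := by
  rw [← Finset.prod_subset (Finset.subset_univ {i, j, k}) (fun m _ hm => ?_)]
  · rw [Finset.prod_insert (by simp [hij, hik]), Finset.prod_pair hjk]
    simp [hij.symm, hik.symm, hjk.symm, mul_assoc]
  · simp only [Finset.mem_insert, Finset.mem_singleton, not_or] at hm
    simp [hm.1, hm.2.1, hm.2.2, hf]

theorem bellSign_zero (s : Fin 4) : bellSign s 0 = 1 := by simp [bellSign]

theorem bellSign_mul_self (s a : Fin 4) : bellSign s a * bellSign s a = 1 := by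
  revert s a; decide

/-- Up to phase the third Pauli matrix is the product of the other two, and conjugation is
multiplicative. -/
theorem bellSign_mul_succ (s : Fin 4) {a b c : Fin 3} (hab : a ≠ b) (hac : a ≠ c) (hbc : b ≠ c) :
    bellSign s a.succ * bellSign s b.succ = bellSign s c.succ := by
  revert s a b c; decide

theorem exists_bellSign_unique {a b : Fin 3} (hab : a ≠ b) {x y : ℤ} (hx : x = 1 ∨ x = -1)
    (hy : y = 1 ∨ y = -1) : ∃ s, ∀ t, t ≠ s → bellSign t a.succ ≠ x ∨ bellSign t b.succ ≠ y := by
  rcases hx with rfl | rfl <;> rcases hy with rfl | rfl <;> revert a b <;> decide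

theorem exists_bellSign_eq (a : Fin 3) {x : ℤ} (hx : x = 1 ∨ x = -1) :
    ∃ s, bellSign s a.succ = x := by
  rcases hx with rfl | rfl <;> revert a <;> decide

theorem bellSign_eq_or (s a : Fin 4) : bellSign s a = 1 ∨ bellSign s a = -1 := by
  revert s a; decide

/-- The combinatorial core of the reachability criterion. `T k a` says that the `a`-th Bloch
component of the target at party `k` does not vanish, `S a` that mixing keeps the size of the
`a`-th components. -/
theorem exists_one_party_of_components {T : Fin 4 → Fin 3 → Prop} {S : Fin 3 → Prop}
    (two_same : ∀ i j a, i ≠ j → T i a → T j a → S a)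
    (two_signs : ∀ a b, a ≠ b → ¬ (S a ∧ S b))
    (two_diff : ∀ i j a b c, i ≠ j → a ≠ b → a ≠ c → b ≠ c → T i a → T j b → ¬ S c)
    (three : ∀ i j k a b c, i ≠ j → i ≠ k → j ≠ k → a ≠ b → a ≠ c → b ≠ c →
      T i a → T j b → ¬ T k c)
    (nonempty : ∃ k a, T k a) (more : ∀ a, S a → ∃ k b, b ≠ a ∧ T k b) :
    ∃ (p : Fin 4) (w : Fin 3), (∀ j, j ≠ p → ∀ v, v ≠ w → ¬ T j v) ∧ ∃ v, v ≠ w ∧ T p v := by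
  by_contra! hcon
  have third : ∀ a b : Fin 3, a ≠ b → ∃ c, c ≠ a ∧ c ≠ b ∧ ∀ v, v = a ∨ v = b ∨ v = c := by
    decide
  -- If mixing keeps an axis `a`, then `w = a`, and `p` is any party with a transverse component.
  by_cases hS : ∃ a, S a
  · obtain ⟨a, ha⟩ := hS
    obtain ⟨i, b, hba, hib⟩ := more a ha
    obtain ⟨c, hca, hcb, hall⟩ := third a b hba.symm
    refine hcon i a (fun j hj v hv hjv => ?_) b hba hib
    rcases hall v with rfl | rfl | rfl
    · exact hv rfl
    · exact two_signs _ _ hba ⟨two_same _ _ _ hj hjv hib, ha⟩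
    · exact two_diff _ _ _ _ _ hj.symm hcb.symm hba hca hib hjv ha
  · push Not at hS
    -- If no axis is kept, each axis is occupied by at most one party; failure of the claim spreads
    -- the three axes over three parties, which `three` excludes.
    have uniq : ∀ i j a, T i a → T j a → i = j := fun i j a hi hj => by
      by_contra hij
      exact hS a (two_same _ _ _ hij hi hj)
    obtain ⟨i, a, hia⟩ := nonempty
    have other : ∀ b c, b ≠ a → c ≠ a → c ≠ b → (∀ v, v = a ∨ v = b ∨ v = c) →
        ∃ j, j ≠ i ∧ T j c := by
      intro b c hba hca hcb hall
      by_contra! h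
      refine hcon i b (fun j hj v hv hjv => ?_) a hba.symm hia
      rcases hall v with rfl | rfl | rfl
      · exact hj (uniq _ _ _ hjv hia)
      · exact hv rfl
      · exact h j hj hjv
    obtain ⟨b, hba⟩ := exists_ne a
    obtain ⟨c, hca, hcb, hall⟩ := third a b hba.symm
    obtain ⟨j, hji, hjc⟩ := other b c hba hca hcb hall
    obtain ⟨k, hki, hkb⟩ := other c b hca hba hcb.symm (fun v => by
      rcases hall v with h | h | h <;> simp [h])
    by_cases hjk : j = k
    · subst hjk
      refine hcon j a (fun m hm v hv hmv => ?_) b hba hkb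
      rcases hall v with rfl | rfl | rfl
      · exact hv rfl
      · exact hm (uniq _ _ _ hmv hkb)
      · exact hm (uniq _ _ _ hmv hjc)
    · exact three i j k a c b hji.symm hki.symm hjk hca.symm hba.symm hcb hia hjc hkb

/-- Product vectors that stay product under a mixture of Pauli conjugations: either the mixture
acts as one of its members, or all parties but one have Bloch vectors along a common axis. -/
theorem sign_or_axis {q : Fin 4 → ℝ} (hq : ∀ s, 0 ≤ q s) (hq1 : ∑ s, q s = 1)
    {x y : Fin 4 → Fin 4 → ℝ} (hx : ∀ k, x k 0 = 1) (hy : ∀ k, y k 0 = 1)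
    (h : ∀ a : Fin 4 → Fin 4,
      ∏ k, x k (a k) = ∑ s, q s * ∏ k, ((bellSign s (a k) : ℝ) * y k (a k))) :
    (∃ s, ∀ k a, x k a = bellSign s a * y k a) ∨
      ∃ (p : Fin 4) (w : Fin 3), (∀ j, j ≠ p → ∀ v, v ≠ w → y j v.succ = 0) ∧
        ∃ v, v ≠ w ∧ y p v.succ ≠ 0 := by
  -- The factor by which mixing shrinks the components along `a`.
  set η : Fin 4 → ℝ := fun a => ∑ s, q s * bellSign s a with hη
  -- Marginals: index 0 at the remaining party contributes the factor 1.
  have multi : ∀ i j k, i ≠ j → i ≠ k → j ≠ k → ∀ a b c,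
      x i a * x j b * x k c = (∑ s, q s * (bellSign s a * bellSign s b * bellSign s c)) *
        (y i a * y j b * y k c) := by
    intro i j k hij hik hjk a b c
    have := h fun m => if m = i then a else if m = j then b else if m = k then c else 0
    rw [prod_ite_three hx hij hik hjk] at this
    rw [this, Finset.sum_mul]
    refine Finset.sum_congr rfl fun s _ => ?_
    rw [prod_ite_three (f := fun m e => (bellSign s e : ℝ) * y m e)
      (fun m => by simp [bellSign_zero, hy]) hij hik hjk]
    ring
  have exists_third : ∀ i j : Fin 4, i ≠ j → ∃ k, i ≠ k ∧ j ≠ k := by decide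
  have pair : ∀ i j, i ≠ j → ∀ a b,
      x i a * x j b = (∑ s, q s * (bellSign s a * bellSign s b)) * (y i a * y j b) := by
    intro i j hij a b
    obtain ⟨k, hik, hjk⟩ := exists_third i j hij
    simpa [hx, hy, bellSign_zero] using multi i j k hij hik hjk a b 0
  have single : ∀ i a, x i a = η a * y i a := by
    intro i a
    obtain ⟨j, hij⟩ : ∃ j, i ≠ j := by revert i; decide
    simpa [hx, hy, bellSign_zero] using pair i j hij a 0
  have η_zero : η 0 = 1 := by simp [hη, bellSign_zero, hq1]
  have pair' : ∀ i j, i ≠ j → ∀ a b, y i a ≠ 0 → y j b ≠ 0 →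
      η a * η b = ∑ s, q s * (bellSign s a * bellSign s b) := by
    intro i j hij a b ha hb
    have := pair i j hij a b
    rw [single, single] at this
    exact mul_right_cancel₀ (mul_ne_zero ha hb) (by linear_combination this)
  have abs_le : ∀ a, η a ^ 2 ≤ 1 := by
    intro a
    rw [sq_le_one_iff_abs_le_one, hη]
    refine (Finset.abs_sum_le_sum_abs _ _).trans (le_of_eq ?_)
    rw [← hq1]
    refine Finset.sum_congr rfl fun s _ => ?_
    rcases bellSign_eq_or s a with h | h <;> simp [h, abs_of_nonneg (hq s)]
  have sign_of_sq : ∀ a, η a ^ 2 = 1 → ∃ e : ℤ, (e = 1 ∨ e = -1) ∧ η a = e := by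
    intro a ha
    rcases sq_eq_sq_iff_eq_or_eq_neg.mp (ha.trans (one_pow 2).symm) with h | h
    · exact ⟨1, Or.inl rfl, by simpa using h⟩
    · exact ⟨-1, Or.inr rfl, by simpa using h⟩
  -- An average of signs is extremal only if all the weight sits on that sign. Extremality on two
  -- axes leaves a single `s`, as used in `point`.
  have weight_zero : ∀ a (e : ℤ), (e = 1 ∨ e = -1) → η a = e → ∀ s, bellSign s a ≠ e → q s = 0 := by
    intro a e he hae
    have h0 : ∑ s, q s * (1 - e * bellSign s a) = 0 := by
      have : ∑ s, q s * (1 - e * bellSign s a) = ∑ s, q s - e * η a := by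
        rw [hη, Finset.mul_sum, ← Finset.sum_sub_distrib]
        exact Finset.sum_congr rfl fun s _ => by ring
      rw [this, hq1, hae]
      rcases he with rfl | rfl <;> norm_num
    intro s hs
    have h1 := (Finset.sum_eq_zero_iff_of_nonneg (fun s _ => mul_nonneg (hq s) (by
      rcases he with rfl | rfl <;> rcases bellSign_eq_or s a with h | h <;> norm_num [h]))).mp h0 s
      (Finset.mem_univ s)
    refine (mul_eq_zero.mp h1).resolve_right ?_
    rcases he with rfl | rfl <;> rcases bellSign_eq_or s a with h | h <;> norm_num [h] <;>
      exact hs h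
  have point : ∀ a b : Fin 3, a ≠ b → η a.succ ^ 2 = 1 → η b.succ ^ 2 = 1 →
      ∃ s, ∀ c, η c = bellSign s c := by
    intro a b hab ha hb
    obtain ⟨e, he, hae⟩ := sign_of_sq _ ha
    obtain ⟨f, hf, hbf⟩ := sign_of_sq _ hb
    obtain ⟨s, hs⟩ := exists_bellSign_unique hab he hf
    have hqs : ∀ t, t ≠ s → q t = 0 := fun t ht =>
      (hs t ht).elim (weight_zero _ e he hae t) (weight_zero _ f hf hbf t)
    have hs1 : q s = 1 := by
      rw [← hq1, Finset.sum_eq_single s (fun t _ ht => hqs t ht) (by simp)]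
    refine ⟨s, fun c => ?_⟩
    simp only [hη]
    rw [Finset.sum_eq_single s (fun t _ ht => by rw [hqs t ht, zero_mul]) (by simp), hs1, one_mul]
  by_contra! hcon
  obtain ⟨hsign, haxis⟩ := hcon
  have not_sign : ∀ s, ∃ k, ∃ a : Fin 3, y k a.succ ≠ 0 ∧ η a.succ ≠ bellSign s a.succ := by
    intro s
    obtain ⟨k, a, hka⟩ := hsign s
    rw [single] at hka
    have hy0 : y k a ≠ 0 := fun h0 => hka (by rw [h0, mul_zero, mul_zero])
    have hne : η a ≠ bellSign s a := fun h0 => hka (by rw [h0])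
    refine ⟨k, ?_⟩
    rcases Fin.eq_zero_or_eq_succ a with rfl | ⟨b, rfl⟩
    · exact absurd (by rw [η_zero, bellSign_zero]; simp) hne
    · exact ⟨b, hy0, hne⟩
  have two_signs : ∀ a b : Fin 3, a ≠ b → ¬ (η a.succ ^ 2 = 1 ∧ η b.succ ^ 2 = 1) := by
    rintro a b hab ⟨ha, hb⟩
    obtain ⟨s, hs⟩ := point a b hab ha hb
    obtain ⟨k, c, -, hc⟩ := not_sign s
    exact hc (hs _)
  have diff : ∀ i j, i ≠ j → ∀ a b c : Fin 3, a ≠ b → a ≠ c → b ≠ c → y i a.succ ≠ 0 →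
      y j b.succ ≠ 0 → η a.succ * η b.succ = η c.succ := by
    intro i j hij a b c hab hac hbc ha hb
    rw [pair' i j hij _ _ ha hb]
    simp only [hη]
    refine Finset.sum_congr rfl fun s _ => ?_
    rw [← Int.cast_mul, bellSign_mul_succ s hab hac hbc]
  have sq_one : ∀ u v : ℝ, u ^ 2 ≤ 1 → v ^ 2 ≤ 1 → (u * v) ^ 2 = 1 → u ^ 2 = 1 ∧ v ^ 2 = 1 := by
    intro u v hu hv huv
    constructor <;> nlinarith [sq_nonneg u, sq_nonneg v]
  obtain ⟨p, w, h1, v, hv, h2⟩ := exists_one_party_of_components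
    (T := fun k a => y k a.succ ≠ 0) (S := fun a => η a.succ ^ 2 = 1)
    (fun i j a hij hi hj => by
      rw [pow_two, pair' i j hij _ _ hi hj, ← hq1]
      refine Finset.sum_congr rfl fun s _ => ?_
      rw [← Int.cast_mul, bellSign_mul_self]
      simp)
    two_signs
    (fun i j a b c hij hab hac hbc hi hj hc =>
      two_signs a b hab (sq_one _ _ (abs_le _) (abs_le _)
        (by rw [diff i j hij a b c hab hac hbc hi hj]; exact hc)))
    (fun i j k a b c hij hik hjk hab hac hbc hi hj hk => by
      have e1 := multi i j k hij hik hjk a.succ b.succ c.succ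
      have e2 : ∑ s, q s * ((bellSign s a.succ : ℝ) * bellSign s b.succ * bellSign s c.succ)
          = 1 := by
        rw [← hq1]
        refine Finset.sum_congr rfl fun s _ => ?_
        rw [← Int.cast_mul, bellSign_mul_succ s hab hac hbc, ← Int.cast_mul, bellSign_mul_self]
        simp
      rw [e2, single, single, single, one_mul] at e1
      have e3 : η a.succ * η b.succ * η c.succ = 1 :=
        mul_right_cancel₀ (mul_ne_zero (mul_ne_zero hi hj) hk) (by linear_combination e1)
      rw [diff i j hij a b c hab hac hbc hi hj] at e3
      have hc : η c.succ ^ 2 = 1 := by rw [pow_two]; exact e3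
      refine two_signs a b hab (sq_one _ _ (abs_le _) (abs_le _) ?_)
      rw [diff i j hij a b c hab hac hbc hi hj]
      exact hc)
    (by
      obtain ⟨k, a, h, -⟩ := not_sign 0
      exact ⟨k, a, h⟩)
    -- If all components lay along `a`, the conjugation whose sign there is `η a` would reproduce
    -- the mixture.
    (fun a ha => by
      obtain ⟨e, he, hae⟩ := sign_of_sq _ ha
      obtain ⟨s, hs⟩ := exists_bellSign_eq a he
      obtain ⟨k, b, hb, hne⟩ := not_sign s
      exact ⟨k, b, fun hba => hne (by rw [hba, hae, hs]), hb⟩)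
  exact h2 (haxis p w (fun j hj v hv => not_not.mp (h1 j hj v hv)) v hv)

end Mixture

/-! ### The reachability criterion -/

section Reachability

theorem IsPauliMixture.prod_gramCoeff {h B : Fin 4 → Matrix (Fin 2) (Fin 2) ℂ}
    (H : IsPauliMixture h (fun k => (B k)ᴴ * B k)) :
    ∃ p : Fin 4 → ℝ, (∀ s, 0 ≤ p s) ∧ ∀ a : Fin 4 → Fin 4, ∏ k, gramCoeff (B k) (a k) =
      ∑ s, p s * ∏ k, ((bellSign s (a k) : ℝ) * gramCoeff (h k) (a k)) := by
  obtain ⟨p, hp, H⟩ := H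
  refine ⟨p, hp, fun a => ?_⟩
  have := H fun k => sigma (a k)
  simp only [trace_sigma_bellOp, ← coe_gramCoeff] at this
  exact_mod_cast this

/-- Dividing by the zeroth coefficients turns the Gram identity into the setting of `sign_or_axis`,
with `x` from the source and `y` from the target. In its first alternative the Gram matrices of `B
k` and `h k * bellOp s` are proportional, which would be an LU-equivalence. -/
theorem one_party_of_reachable {z : Fin 4 → ℂ} (hz : IsGenericSeed z) (h : Fin 4 → GL (Fin 2) ℂ)
    (hr : ReachableFromOther (seedOrbit h z)) :
    ∃ (p : Fin 4) (w : Fin 3), (∀ j, j ≠ p → IsPauliForm w (h j)) ∧ ¬ IsPauliForm w (h p) := by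
  obtain ⟨φ, hne, hlu, hφ⟩ := hr
  obtain ⟨B, hB⟩ := hφ.exists_eq_localOp_seed hz h hne
  obtain ⟨⟨L, hL⟩, hmix⟩ := hφ.isPauliMixture hz h hne B hB
  have hBdet : ∀ k, (B k).det ≠ 0 := fun k h0 => by
    have := congrArg Matrix.det (hL k)
    rw [Matrix.det_mul, h0, mul_zero, Matrix.det_one] at this
    exact zero_ne_one this
  obtain ⟨p, hp, H⟩ := hmix.prod_gramCoeff
  have hB0 : ∀ k, 0 < gramCoeff (B k) 0 := fun k => gramCoeff_zero_pos (hBdet k)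
  have hh0 : ∀ k, 0 < gramCoeff (h k).val 0 := fun k => gramCoeff_zero_pos (GL_det_ne_zero _)
  have H0 : ∏ k, gramCoeff (B k) 0 = (∑ s, p s) * ∏ k, gramCoeff (h k).val 0 := by
    rw [H fun _ => 0, Finset.sum_mul]
    simp [bellSign_zero]
  have hBp : 0 < ∏ k, gramCoeff (B k) 0 := Finset.prod_pos fun k _ => hB0 k
  have hhp : 0 < ∏ k, gramCoeff (h k).val 0 := Finset.prod_pos fun k _ => hh0 k
  have hP : 0 < ∑ s, p s := by
    rw [H0] at hBp
    exact (pos_iff_pos_of_mul_pos hBp).mpr hhp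
  rcases sign_or_axis (q := fun s => p s / ∑ t, p t)
    (x := fun k a => gramCoeff (B k) a / gramCoeff (B k) 0)
    (y := fun k a => gramCoeff (h k).val a / gramCoeff (h k).val 0)
    (fun s => div_nonneg (hp s) hP.le) (by rw [← Finset.sum_div, div_self hP.ne'])
    (fun k => div_self (hB0 k).ne') (fun k => div_self (hh0 k).ne') (fun a => by
      rw [Finset.prod_div_distrib, H a, H0, Finset.sum_div]
      refine Finset.sum_congr rfl fun s _ => ?_
      simp only [← mul_div_assoc]
      rw [Finset.prod_div_distrib]
      field_simp) with ⟨s, hs⟩ | ⟨q, w, h1, v, hv, h2⟩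
  · refine absurd ?_ hlu
    have hu : ∀ k, ∃ (u : Matrix.unitaryGroup (Fin 2) ℂ) (c : ℂ), c ≠ 0 ∧
        (h k).val * bellOp s = c • (u.val * B k) := fun k => by
      refine exists_unitary_of_gramCoeff
        (r := gramCoeff (h k).val 0 / gramCoeff (B k) 0) ?_ (hBdet k) fun a => ?_
      · rw [Matrix.det_mul]
        refine mul_ne_zero (GL_det_ne_zero _) fun h0 => ?_
        have := congrArg Matrix.det (bellOp_mul_transpose s)
        rw [Matrix.det_mul, h0, zero_mul, Matrix.det_one] at this
        exact zero_ne_one this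
      · rw [gramCoeff_mul_bellOp]
        have := (hB0 k).ne'
        have := (hh0 k).ne'
        have e := hs k a
        field_simp at e ⊢
        linear_combination -e
    choose u c hc hu using hu
    refine ⟨u, ∏ k, c k, Finset.prod_ne_zero_iff.mpr fun k _ => hc k, ?_⟩
    rw [hB, localOp_localOp, ← localOp_smul_op]
    simp only [← hu]
    rw [← localOp_localOp, localOp_bellOp_seed, seedOrbit]
  · refine ⟨q, w, fun j hj => isPauliForm_iff.mpr fun v hv => ?_, fun hw => ?_⟩
    · exact (div_eq_zero_iff.mp (h1 j hj v hv)).resolve_right (hh0 j).ne'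
    · refine h2 ?_
      rw [isPauliForm_iff.mp hw v hv, zero_div]

theorem gram_eq_of_gramCoeff {A B : Matrix (Fin 2) (Fin 2) ℂ}
    (h : ∀ a, gramCoeff A a = gramCoeff B a) : Aᴴ * A = Bᴴ * B := by
  rw [← one_smul ℂ (Bᴴ * B)]
  exact eq_smul_of_trace_sigma fun a => by rw [← coe_gramCoeff, ← coe_gramCoeff, h a, one_mul]

theorem bellSign_succ_of_ne {v w : Fin 3} (h : v ≠ w) : bellSign w.succ v.succ = -1 := by
  revert v w; decide

theorem bellSign_self (s : Fin 4) : bellSign s s = 1 := by simp [bellSign]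

/-- The one-round protocol behind the reachable states: party `p` performs a two-outcome
measurement, the other parties correct by unitaries. -/
theorem reaches_of_gram (z : Fin 4 → ℂ) (h : Fin 4 → GL (Fin 2) ℂ) (p s : Fin 4)
    {N : Matrix (Fin 2) (Fin 2) ℂ} (hN : N.det ≠ 0)
    (hgram : ((h p).val)ᴴ * (h p).val + ((h p).val * bellOp s)ᴴ * ((h p).val * bellOp s) =
      (2 : ℂ) • (Nᴴ * N))
    (hiso : ∀ j, j ≠ p → ((h j).val * bellOp s * ((h j)⁻¹).val)ᴴ *
      ((h j).val * bellOp s * ((h j)⁻¹).val) = 1) :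
    LOCCReaches (seedOrbit h z)
      (localOp (Function.update (fun j => (h j).val) p N : Fin 4 → Matrix (Fin 2) (Fin 2) ℂ)
        (seed z)) := by
  have hNu : IsUnit N.det := isUnit_iff_ne_zero.mpr hN
  set g : Fin 4 → Matrix (Fin 2) (Fin 2) ℂ := Function.update (fun j => (h j).val) p N with hg
  have hgp : g p = N := Function.update_self ..
  have hgj : ∀ j, j ≠ p → g j = (h j).val := fun j hjp => Function.update_of_ne hjp ..
  set κ : ℂ := (Real.sqrt (1 / 2) : ℂ) with hκ
  have hκκ : star κ * κ = 1 / 2 := by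
    rw [hκ, Complex.star_def, Complex.conj_ofReal, ← Complex.ofReal_mul,
      Real.mul_self_sqrt (by norm_num)]
    norm_num
  let Q : Fin 2 → Matrix (Fin 2) (Fin 2) ℂ := ![1, bellOp s]
  -- Outcome `k` turns the source into `h Q Ψ` with `Q` at every party, and the symmetry `Q` of the
  -- seed removes `Q`. Both outcomes carry weight 1/2.
  let A : Fin 2 → Fin 4 → Matrix (Fin 2) (Fin 2) ℂ := fun k j =>
    if j = p then κ • ((h p).val * Q k * N⁻¹) else (h j).val * Q k * ((h j)⁻¹).val
  have hQ : ∀ k, localOp (fun _ => Q k) (seed z) = seed z := by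
    intro k
    fin_cases k
    · exact localOp_one (d := fun _ => 2) _
    · exact localOp_bellOp_seed _ _
  have hA : ∀ k, localOp (A k) (localOp g (seed z)) = κ • seedOrbit h z := by
    intro k
    have : (fun j => A k j * g j) =
        fun j => (if j = p then κ else 1 : ℂ) • ((h j).val * Q k) := by
      funext j
      by_cases hjp : j = p
      · rw [hjp, hgp]
        simp only [A, if_true]
        rw [Matrix.smul_mul, mul_assoc, Matrix.nonsing_inv_mul _ hNu, mul_one]
      · simp only [A, if_neg hjp, hgj j hjp, one_smul]
        rw [mul_assoc, GL_inv_mul_self, mul_one]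
    rw [localOp_localOp, this, localOp_smul_op (d := fun _ => 2) (e := fun _ => 2),
      ← localOp_localOp, hQ, seedOrbit]
    simp
  refine LOCCReaches.round (t := fun _ => 2) _ p 2 (fun _ _ => 2) A ?_ ?_ ?_
  · have hKK : ∀ k, (A k p)ᴴ * A k p =
        (1 / 2 : ℂ) • ((N⁻¹)ᴴ * (((h p).val * Q k)ᴴ * ((h p).val * Q k)) * N⁻¹) := by
      intro k
      simp only [A, if_true]
      rw [Matrix.conjTranspose_smul, Matrix.smul_mul, Matrix.mul_smul _ κ, smul_smul, hκκ,
        Matrix.conjTranspose_mul]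
      simp only [mul_assoc]
    rw [Fin.sum_univ_two]
    refine (congrArg₂ (· + ·) (hKK 0) (hKK 1)).trans ?_
    rw [← smul_add, ← Matrix.add_mul, ← Matrix.mul_add]
    have hQQ : ((h p).val * Q 0)ᴴ * ((h p).val * Q 0) +
        ((h p).val * Q 1)ᴴ * ((h p).val * Q 1) = (2 : ℂ) • (Nᴴ * N) := by
      rw [← hgram]
      simp [Q]
    rw [hQQ, Matrix.mul_smul, Matrix.smul_mul, smul_smul, ← mul_assoc,
      ← Matrix.conjTranspose_mul, Matrix.mul_nonsing_inv _ hNu, Matrix.conjTranspose_one, one_mul,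
      Matrix.mul_nonsing_inv _ hNu]
    norm_num
  · intro k j hjp
    simp only [A, if_neg hjp]
    fin_cases k
    · simp [Q]
    · exact hiso j hjp
  · intro k
    have := hA k
    exact this ▸ LOCCReaches.done κ

/-- The source carries at `p` an operator `N` whose Gram matrix is the average of that of `h p` and
its conjugate by `W`; averaging deletes the transverse Bloch components. Elsewhere `W` commutes with
the Gram matrix, so `h j * W * (h j)⁻¹` is unitary. By rigidity of the orbit an LU-equivalence would
force the transverse components of `h p` to vanish. -/
theorem reachable_of_one_party {z : Fin 4 → ℂ} (hz : IsGenericSeed z) (h : Fin 4 → GL (Fin 2) ℂ)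
    {p : Fin 4} {w : Fin 3} (hj : ∀ j, j ≠ p → IsPauliForm w (h j))
    (hp : ¬ IsPauliForm w (h p)) : ReachableFromOther (seedOrbit h z) := by
  have hpdet := GL_det_ne_zero (h p)
  obtain ⟨r, t, hr, hdet, h0, h1, h2⟩ :=
    exists_gramCoeff_one_add w (gramCoeff_zero_pos hpdet) (sq_gramCoeff_lt hpdet w)
  set N : Matrix (Fin 2) (Fin 2) ℂ := (Real.sqrt r : ℂ) • (1 + (t : ℂ) • pauli w) with hN
  have hsq : ‖(Real.sqrt r : ℂ)‖ ^ 2 = r := by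
    rw [Complex.norm_real, Real.norm_eq_abs, sq_abs, Real.sq_sqrt hr.le]
  have hNdet : N.det ≠ 0 := by
    rw [hN, Matrix.det_smul]
    refine mul_ne_zero (pow_ne_zero _ ?_) hdet
    exact_mod_cast (Real.sqrt_pos.mpr hr).ne'
  have hN0 : gramCoeff N 0 = gramCoeff (h p).val 0 := by rw [hN, gramCoeff_smul, hsq, h0]
  have hN1 : gramCoeff N w.succ = gramCoeff (h p).val w.succ := by
    rw [hN, gramCoeff_smul, hsq, h1]
  have hN2 : ∀ v, v ≠ w → gramCoeff N v.succ = 0 := fun v hv => by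
    rw [hN, gramCoeff_smul, h2 v hv, mul_zero]
  set T := bellOp w.succ with hT
  have hgram : ((h p).val)ᴴ * (h p).val + ((h p).val * T)ᴴ * ((h p).val * T) =
      (2 : ℂ) • (Nᴴ * N) := by
    refine eq_smul_of_trace_sigma fun a => ?_
    rw [Matrix.mul_add, Matrix.trace_add, ← coe_gramCoeff, ← coe_gramCoeff, ← coe_gramCoeff,
      gramCoeff_mul_bellOp]
    refine Fin.cases ?_ (fun v => ?_) a
    · rw [hN0, bellSign_zero]
      push_cast
      ring
    · by_cases hv : v = w
      · rw [hv, hN1, bellSign_self]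
        push_cast
        ring
      · rw [hN2 v hv, bellSign_succ_of_ne hv]
        push_cast
        ring
  have hiso : ∀ j, j ≠ p →
      ((h j).val * T * ((h j)⁻¹).val)ᴴ * ((h j).val * T * ((h j)⁻¹).val) = 1 := by
    intro j hjp
    have e : ((h j).val * T)ᴴ * ((h j).val * T) = ((h j).val)ᴴ * (h j).val := by
      refine gram_eq_of_gramCoeff fun a => ?_
      rw [gramCoeff_mul_bellOp]
      refine Fin.cases ?_ (fun v => ?_) a
      · simp [bellSign_zero]
      · by_cases hv : v = w
        · simp [hv, bellSign_self]
        · rw [isPauliForm_iff.mp (hj j hjp) v hv, mul_zero]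
    rw [Matrix.conjTranspose_mul, mul_assoc, ← mul_assoc ((h j).val * T)ᴴ, e, mul_assoc,
      GL_mul_inv_self, mul_one, ← Matrix.conjTranspose_mul, GL_mul_inv_self,
      Matrix.conjTranspose_one]
  let gN : Fin 4 → GL (Fin 2) ℂ :=
    Function.update h p (Matrix.GeneralLinearGroup.mkOfDetNeZero N hNdet)
  have hgp : (gN p).val = N := by
    simp [gN, Matrix.GeneralLinearGroup.mkOfDetNeZero]
  have hg : (fun j => (gN j).val) = Function.update (fun j => (h j).val) p N := by
    funext j
    by_cases hjp : j = p
    · rw [hjp, hgp, Function.update_self]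
    · simp [gN, Function.update_of_ne hjp]
  have hreach : LOCCReaches (seedOrbit h z) (seedOrbit gN z) := by
    rw [seedOrbit.eq_def gN, hg]
    exact reaches_of_gram z h p w.succ hNdet hgram hiso
  refine ⟨seedOrbit gN z, seedOrbit_ne_zero hz gN, ?_, hreach⟩
  rintro ⟨u, c, hc, hu⟩
  rw [seedOrbit.eq_def gN, localOp_localOp] at hu
  have hu' : localOp (fun i => (u i).val * (gN i).val) (seed z) = c⁻¹ • seedOrbit h z := by
    rw [hu, smul_smul, inv_mul_cancel₀ hc, one_smul]
  obtain ⟨s, a, hs⟩ := hz.eq_mul_bellOp h (inv_ne_zero hc) hu'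
  have hap : a p ≠ 0 := fun h0 => by
    have := det_ne_zero_of_localOp_eq hz h (inv_ne_zero hc) hu' p
    rw [hs p, h0, zero_smul] at this
    exact this Matrix.det_zero
  refine hp (isPauliForm_iff.mpr fun v hv => ?_)
  have e := congrArg (fun M => gramCoeff M v.succ) (hs p)
  simp only [gramCoeff_unitary_mul, hgp, hN2 v hv, gramCoeff_smul, gramCoeff_mul_bellOp] at e
  have hn : ‖a p‖ ^ 2 ≠ 0 := pow_ne_zero _ (norm_ne_zero_iff.mpr hap)
  have hsg : (bellSign s v.succ : ℝ) ≠ 0 := by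
    rcases bellSign_eq_or s v.succ with h | h <;> simp [h]
  exact (mul_eq_zero.mp ((mul_eq_zero.mp e.symm).resolve_left hn)).resolve_left hsg

theorem reachable_iff {z : Fin 4 → ℂ} (hz : IsGenericSeed z) (h : Fin 4 → GL (Fin 2) ℂ) :
    ReachableFromOther (seedOrbit h z) ↔
      ∃ (p : Fin 4) (w : Fin 3), (∀ j, j ≠ p → IsPauliForm w (h j)) ∧ ¬ IsPauliForm w (h p) :=
  ⟨one_party_of_reachable hz h, fun ⟨_, _, hj, hp⟩ => reachable_of_one_party hz h hj hp⟩

theorem exists_not_isPauliForm {g : GL (Fin 2) ℂ} (hg : ¬ IsTrivialForm g) :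
    ∃ w, ¬ IsPauliForm w g := by
  by_contra! h
  exact hg (isTrivialForm_of_isPauliForm (w := 0) (v := 1) (by decide) (h 0) (h 1))

end Reachability

/-! ### The 12-parameter families -/

section Parametrization

/-- An invertible matrix is, up to a unitary on the left and a scalar, upper triangular with
diagonal `1, r`, where `r` is real. -/
theorem exists_upper_triangular (g : GL (Fin 2) ℂ) :
    ∃ (u : Matrix.unitaryGroup (Fin 2) ℂ) (c ζ : ℂ) (r : ℝ), c ≠ 0 ∧
      g.val = c • (u.val * !![1, ζ; 0, (r : ℂ)]) := by
  have hdet := GL_det_ne_zero g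
  set a := g.val 0 0 with ha
  set b := g.val 0 1 with hb
  set c := g.val 1 0 with hc
  set d := g.val 1 1 with hd
  have hg : g.val = !![a, b; c, d] := by
    ext i j
    fin_cases i <;> fin_cases j <;> rfl
  rw [Matrix.det_fin_two, ← ha, ← hb, ← hc, ← hd] at hdet
  set α : ℝ := Complex.normSq a + Complex.normSq c with hα
  have hα0 : 0 < α := by
    by_contra hle
    have h1 := Complex.normSq_nonneg a
    have h2 := Complex.normSq_nonneg c
    have h3 : a = 0 := Complex.normSq_eq_zero.mp (by linarith)
    have h4 : c = 0 := Complex.normSq_eq_zero.mp (by linarith)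
    exact hdet (by rw [h3, h4]; ring)
  have hαC : (α : ℂ) ≠ 0 := by exact_mod_cast hα0.ne'
  have hα' : (α : ℂ) = star a * a + star c * c := by
    rw [hα, Complex.star_def, ← Complex.normSq_eq_conj_mul_self,
      ← Complex.normSq_eq_conj_mul_self]
    push_cast
    rfl
  set δ : ℂ := a * d - b * c with hδ
  have hδ0 : 0 < ‖δ‖ := norm_pos_iff.mpr hdet
  have hδδ : (‖δ‖ : ℂ) ^ 2 = star δ * δ := by
    rw [Complex.star_def, ← Complex.normSq_eq_conj_mul_self, Complex.normSq_eq_norm_sq]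
    push_cast
    rfl
  have hr0 : ((‖δ‖ / α : ℝ) : ℂ) ≠ 0 := by
    exact_mod_cast (div_pos hδ0 hα0).ne'
  -- Gram–Schmidt on the columns: `α` is the squared length of the first, and `r = ‖det‖ / α`.
  obtain ⟨u, κ, hκ, hu⟩ := exists_unitary_of_gram (A := g.val)
    (B := !![1, (star a * b + star c * d) / α; 0, ((‖δ‖ / α : ℝ) : ℂ)])
    (by simpa [Matrix.det_fin_two] using hr0) hα0 (by
      have hsα : star (α : ℂ) = α := Complex.conj_ofReal _
      have hsδ : star (‖δ‖ : ℂ) = ‖δ‖ := Complex.conj_ofReal _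
      rw [hg]
      ext i j
      simp only [Matrix.mul_apply, Fin.sum_univ_two, Matrix.conjTranspose_apply,
        Matrix.smul_apply, smul_eq_mul]
      fin_cases i <;> fin_cases j <;> simp only [Matrix.of_apply, Matrix.cons_val', Matrix.cons_val,
        star_one, star_zero, Complex.ofReal_div, star_div₀, star_add, star_mul', star_star,
        Fin.mk_zero, Fin.mk_one, hsα, hsδ, Matrix.cons_val_fin_one, Fin.isValue]
      · rw [hα']; ring
      · field_simp
        ring
      · field_simp
        ring
      · field_simp
        rw [hδδ, hδ, hα']
        simp only [star_sub, star_mul']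
        ring)
  exact ⟨u, κ, _, _, hκ, hu⟩

theorem seed_smul (c : ℂ) (z : Fin 4 → ℂ) : seed (fun i => c * z i) = c • seed z := by
  funext x
  simp only [seed, Pi.add_apply, Pi.smul_apply, smul_eq_mul]
  ring

/-- The local operators of a reachable state, up to local unitaries and scalars: `p` carries an
upper triangular matrix, the other parties are of the form `h_w`. -/
noncomputable def reachableOp (p : Fin 4) (w : Fin 3) (t : Fin 12 → ℝ) :
    Fin 4 → Matrix (Fin 2) (Fin 2) ℂ :=
  p.insertNth (α := fun _ => Matrix (Fin 2) (Fin 2) ℂ)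
    !![1, (t 0 : ℂ) + t 1 * Complex.I; 0, (t 2 : ℂ)]
    fun k => 1 + ((![t 3, t 4, t 5] k : ℝ) : ℂ) • pauli w

/-- Seed parameters normalised by setting the one with index `i` to `1`. -/
noncomputable def reachableSeed (i : Fin 4) (t : Fin 12 → ℝ) : Fin 4 → ℂ :=
  i.insertNth (α := fun _ => ℂ) 1
    ![(t 6 : ℂ) + t 7 * Complex.I, t 8 + t 9 * Complex.I, t 10 + t 11 * Complex.I]

/-- The 12-parameter families of reachable states. -/
noncomputable def reachableFamily (k : Fin 4 × Fin 4 × Fin 3) (t : Fin 12 → ℝ) : QubitState 4 :=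
  localOp (reachableOp k.2.1 k.2.2 t) (seed (reachableSeed k.1 t))

theorem exists_reachableFamily {z : Fin 4 → ℂ} (hz : IsGenericSeed z) (h : Fin 4 → GL (Fin 2) ℂ)
    {p : Fin 4} {w : Fin 3} (hj : ∀ j, j ≠ p → IsPauliForm w (h j)) :
    ∃ k t, LUEquiv (reachableFamily k t) (seedOrbit h z) := by
  -- A parameter may vanish, so the index normalised to 1 is part of the label of the family.
  obtain ⟨i, hi⟩ : ∃ i, z i ≠ 0 := by
    rcases hz.exists_ne_zero (i := 0) (j := 1) (by decide) with h | h
    exacts [⟨_, h⟩, ⟨_, h⟩]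
  obtain ⟨u₀, c₀, ζ, r, hc₀, h₀⟩ := exists_upper_triangular (h p)
  have hax : ∀ k, ∃ (u : Matrix.unitaryGroup (Fin 2) ℂ) (c : ℂ) (t : ℝ), c ≠ 0 ∧
      (h (p.succAbove k)).val = c • (u.val * (1 + (t : ℂ) • pauli w)) := fun k =>
    exists_one_add_of_gramCoeff fun v hv =>
      isPauliForm_iff.mp (hj _ (Fin.succAbove_ne p k)) v hv
  choose u c s hc hu using hax
  let y : Fin 3 → ℂ := fun k => z (i.succAbove k) / z i
  let t : Fin 12 → ℝ := ![ζ.re, ζ.im, r, s 0, s 1, s 2, (y 0).re, (y 0).im, (y 1).re, (y 1).im,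
    (y 2).re, (y 2).im]
  refine ⟨(i, p, w), t, ?_⟩
  have hseed : (fun j => z i * reachableSeed i t j) = z := by
    funext j
    rcases Fin.eq_self_or_eq_succAbove i j with rfl | ⟨k, rfl⟩
    · simp [reachableSeed]
    · have : reachableSeed i t (i.succAbove k) = y k := by
        rw [reachableSeed, Fin.insertNth_apply_succAbove]
        fin_cases k <;> exact Complex.re_add_im _
      rw [this]
      exact mul_div_cancel₀ _ hi
  have hop : ∀ j, ∃ (u : Matrix.unitaryGroup (Fin 2) ℂ) (c : ℂ), c ≠ 0 ∧
      (h j).val = c • (u.val * reachableOp p w t j) := by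
    intro j
    rcases Fin.eq_self_or_eq_succAbove p j with rfl | ⟨k, rfl⟩
    · refine ⟨u₀, c₀, hc₀, ?_⟩
      rw [reachableOp, Fin.insertNth_apply_same]
      have : ((t 0 : ℂ) + t 1 * Complex.I) = ζ := Complex.re_add_im _
      rw [this]
      exact h₀
    · refine ⟨u k, c k, hc k, ?_⟩
      rw [reachableOp, Fin.insertNth_apply_succAbove, hu k]
      have : ![t 3, t 4, t 5] k = s k := by fin_cases k <;> rfl
      rw [this]
  choose U C hC hU using hop
  refine ⟨U, (∏ j, C j) * z i, mul_ne_zero (Finset.prod_ne_zero_iff.mpr fun j _ => hC j) hi, ?_⟩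
  rw [seedOrbit, reachableFamily, localOp_localOp]
  conv_lhs => rw [← hseed]
  rw [seed_smul, localOp_smul_state, mul_comm, mul_smul, ← localOp_smul_op]
  simp only [hU]

theorem contDiff_localOp {E : Type*} [NormedAddCommGroup E] [NormedSpace ℝ E]
    {A : E → Fin 4 → Matrix (Fin 2) (Fin 2) ℂ} {φ : E → QubitState 4}
    (hA : ∀ i a b, ContDiff ℝ ∞ fun t => A t i a b) (hφ : ContDiff ℝ ∞ φ) :
    ContDiff ℝ ∞ fun t => localOp (A t) (φ t) := by
  rw [contDiff_pi]
  intro y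
  refine ContDiff.sum fun x _ => ContDiff.mul (contDiff_prod fun i _ => hA i _ _) ?_
  exact contDiff_pi.mp hφ x

theorem contDiff_reachableFamily (k : Fin 4 × Fin 4 × Fin 3) :
    ContDiff ℝ ∞ (reachableFamily k) := by
  have hcoe : ∀ i : Fin 12, ContDiff ℝ ∞ fun t : Fin 12 → ℝ => (t i : ℂ) := fun i =>
    Complex.ofRealCLM.contDiff.comp (contDiff_apply ℝ ℝ i)
  refine contDiff_localOp (fun j a b => ?_) ?_
  · rcases Fin.eq_self_or_eq_succAbove k.2.1 j with rfl | ⟨l, rfl⟩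
    · simp only [reachableOp, Fin.insertNth_apply_same]
      fin_cases a <;> fin_cases b
      · exact contDiff_const
      · exact (hcoe 0).add ((hcoe 1).mul contDiff_const)
      · exact contDiff_const
      · exact hcoe 2
    · simp only [reachableOp, Fin.insertNth_apply_succAbove, Matrix.add_apply, Matrix.smul_apply,
        smul_eq_mul]
      refine contDiff_const.add (ContDiff.mul ?_ contDiff_const)
      fin_cases l
      exacts [hcoe 3, hcoe 4, hcoe 5]
  · have hs : ∀ j, ContDiff ℝ ∞ fun t => reachableSeed k.1 t j := by
      intro j
      rcases Fin.eq_self_or_eq_succAbove k.1 j with rfl | ⟨l, rfl⟩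
      · simp only [reachableSeed, Fin.insertNth_apply_same]
        exact contDiff_const
      · simp only [reachableSeed, Fin.insertNth_apply_succAbove]
        fin_cases l
        exacts [(hcoe 6).add ((hcoe 7).mul contDiff_const),
          (hcoe 8).add ((hcoe 9).mul contDiff_const), (hcoe 10).add ((hcoe 11).mul contDiff_const)]
    have h0 := hs 0
    have h1 := hs 1
    have h2 := hs 2
    have h3 := hs 3
    rw [contDiff_pi]
    intro x
    simp only [seed, Pi.add_apply, Pi.smul_apply, smul_eq_mul]
    fun_prop

end Parametrization

/-! ### Dimension counts and null sets -/

section NullSets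

/-- The range of a smooth map from a space of smaller dimension is a null set. -/
theorem measure_range_eq_zero_of_finrank_lt {E F : Type*} [NormedAddCommGroup E] [NormedSpace ℝ E]
    [FiniteDimensional ℝ E] [NormedAddCommGroup F] [NormedSpace ℝ F] [FiniteDimensional ℝ F]
    [MeasurableSpace F] [BorelSpace F] (μ : Measure F) [μ.IsAddHaarMeasure] {g : E → F}
    (hg : ContDiff ℝ ∞ g) (h : Module.finrank ℝ E < Module.finrank ℝ F) :
    μ (Set.range g) = 0 := by
  let e : F ≃L[ℝ] E × (Fin (Module.finrank ℝ F - Module.finrank ℝ E) → ℝ) :=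
    ContinuousLinearEquiv.ofFinrankEq (by
      rw [Module.finrank_prod, Module.finrank_fin_fun]
      omega)
  -- Precomposing with a projection keeps the range and gives a self-map of `F` whose derivative
  -- factors through `E`, hence is singular.
  let π : F →L[ℝ] E := (ContinuousLinearMap.fst ℝ _ _).comp e.toContinuousLinearMap
  have hπ : Function.Surjective π := fun x => ⟨e.symm (x, 0), by simp [π]⟩
  have hrange : Set.range g = (g ∘ π) '' Set.univ := by
    rw [Set.image_univ, hπ.range_comp]
  rw [hrange]
  refine addHaar_image_eq_zero_of_det_fderivWithin_eq_zero μ (f' := fun x => (fderiv ℝ g (π x)).comp π)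
    (fun x _ => ?_) fun x _ => ?_
  · have h1 : HasFDerivAt g (fderiv ℝ g (π x)) (π x) :=
      ((hg.differentiable (by simp)) (π x)).hasFDerivAt
    exact (h1.comp x π.hasFDerivAt).hasFDerivWithinAt
  · by_contra hdet
    have hinj : Function.Injective ((fderiv ℝ g (π x)).comp π) :=
      (LinearMap.equivOfDetNeZero _ hdet).injective
    have hinjπ : Function.Injective π := fun a b hab => hinj (by simp [hab])
    exact absurd (LinearMap.finrank_le_finrank_of_injective (f := π.toLinearMap) hinjπ) (not_le.mpr h)

theorem finrank_qubitState_four : Module.finrank ℝ (QubitState 4) = 32 := by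
  rw [Module.finrank_pi_fintype]
  simp

/-- Dividing by a square root `κ` of the determinant leads to SU(2). Each unitary then costs 4 real
parameters, and the four phases merge into one scalar. -/
theorem exists_smul_quaternion (u : Matrix.unitaryGroup (Fin 2) ℂ) :
    ∃ κ x y : ℂ, u.val = κ • !![x, -star y; y, star x] := by
  have h1 : (u.val)ᴴ * u.val = 1 := Unitary.coe_star_mul_self u
  have h00 := congrFun (congrFun h1 0) 0
  have h01 := congrFun (congrFun h1 0) 1
  have hd : star u.val.det * u.val.det = 1 := by
    rw [← Matrix.det_conjTranspose, ← Matrix.det_mul, h1, Matrix.det_one]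
  obtain ⟨κ, hκ⟩ := IsAlgClosed.exists_pow_nat_eq u.val.det (n := 2) (by norm_num)
  have hκκ : star κ * κ = 1 := by
    have : (Complex.normSq κ : ℂ) ^ 2 = 1 := by
      rw [Complex.normSq_eq_conj_mul_self, mul_pow, ← map_pow, hκ]
      exact hd
    have h2 : Complex.normSq κ ^ 2 = 1 := by exact_mod_cast this
    have h3 : Complex.normSq κ = 1 := by nlinarith [Complex.normSq_nonneg κ]
    rw [Complex.star_def, ← Complex.normSq_eq_conj_mul_self, h3, Complex.ofReal_one]
  simp only [Matrix.mul_apply, Fin.sum_univ_two, Matrix.conjTranspose_apply, Matrix.one_apply_eq]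
    at h00 h01
  simp only [ne_eq, zero_ne_one, not_false_eq_true, Matrix.one_apply_ne] at h01
  rw [Matrix.det_fin_two] at hκ
  refine ⟨κ, star κ * u.val 0 0, star κ * u.val 1 0, ?_⟩
  ext i j
  fin_cases i <;> fin_cases j <;> simp only [Matrix.smul_apply, smul_eq_mul, Matrix.of_apply,
    Matrix.cons_val', Matrix.cons_val, star_mul', star_star, Fin.mk_zero, Fin.mk_one,
    Fin.isValue, Matrix.cons_val_fin_one]
  · linear_combination -(u.val 0 0) * hκκ
  · linear_combination star (u.val 1 0) * hκ - u.val 0 1 * h00 + u.val 0 0 * h01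
  · linear_combination -(u.val 1 0) * hκκ
  · linear_combination -star (u.val 0 0) * hκ - u.val 1 1 * h00 + u.val 1 0 * h01

/-- The union of the LU orbits of the points of the `k`-th family, as the range of one map. -/
noncomputable def reachableOrbit (k : Fin 4 × Fin 4 × Fin 3)
    (v : (Fin 12 → ℝ) × (Fin 4 → ℂ × ℂ) × ℂ) : QubitState 4 :=
  v.2.2 • localOp
    (fun i => !![(v.2.1 i).1, -star (v.2.1 i).2; (v.2.1 i).2, star (v.2.1 i).1])
    (reachableFamily k v.1)

theorem contDiff_reachableOrbit (k : Fin 4 × Fin 4 × Fin 3) : ContDiff ℝ ∞ (reachableOrbit k) := by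
  have h1 : ∀ i, ContDiff ℝ ∞ fun v : (Fin 12 → ℝ) × (Fin 4 → ℂ × ℂ) × ℂ => (v.2.1 i).1 := by
    intro i; fun_prop
  have h2 : ∀ i, ContDiff ℝ ∞ fun v : (Fin 12 → ℝ) × (Fin 4 → ℂ × ℂ) × ℂ => (v.2.1 i).2 := by
    intro i; fun_prop
  refine ContDiff.smul (contDiff_snd.comp contDiff_snd) (contDiff_localOp (fun i a b => ?_)
    ((contDiff_reachableFamily k).comp contDiff_fst))
  fin_cases a <;> fin_cases b
  · exact h1 i
  · exact (Complex.conjCLE.contDiff.comp (h2 i)).neg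
  · exact h2 i
  · exact Complex.conjCLE.contDiff.comp (h1 i)

theorem mem_range_reachableOrbit {k : Fin 4 × Fin 4 × Fin 3} {t : Fin 12 → ℝ} {φ : QubitState 4}
    (h : LUEquiv (reachableFamily k t) φ) : φ ∈ Set.range (reachableOrbit k) := by
  obtain ⟨u, c, -, rfl⟩ := h
  choose κ x y hu using fun i => exists_smul_quaternion (u i)
  refine ⟨(t, fun i => (x i, y i), c * ∏ i, κ i), ?_⟩
  simp only [reachableOrbit, hu]
  rw [localOp_smul_op (d := fun _ => 2) (e := fun _ => 2), smul_smul]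

/-- The count is 12 + 16 + 2 = 30 < 32. -/
theorem volume_range_reachableOrbit (k : Fin 4 × Fin 4 × Fin 3) :
    volume (Set.range (reachableOrbit k)) = 0 := by
  refine measure_range_eq_zero_of_finrank_lt _ (contDiff_reachableOrbit k) ?_
  rw [finrank_qubitState_four, Module.finrank_prod, Module.finrank_prod, Module.finrank_fin_fun,
    Module.finrank_pi_fintype]
  simp [Module.finrank_prod]

/-- The states that factorise across the bipartition `S | Sᶜ`. -/
def productState (S : Set (Fin 4))
    (v : ((S → Fin 2) → ℂ) × (((Sᶜ : Set (Fin 4)) → Fin 2) → ℂ)) : QubitState 4 :=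
  fun x => v.1 (fun i => x i) * v.2 (fun i => x i)

open Classical in
-- For `n` parties on one side the count is `2 * (2 ^ n + 2 ^ (4 - n))`, at most 20.
theorem volume_range_productState {S : Set (Fin 4)} (hS : S.Nonempty) (hSc : Sᶜ.Nonempty) :
    volume (Set.range (productState S)) = 0 := by
  refine measure_range_eq_zero_of_finrank_lt _ ?_ ?_
  · rw [contDiff_pi]
    intro x
    simp only [productState]
    fun_prop
  · have h1 : 0 < Fintype.card S := Fintype.card_pos_iff.mpr hS.to_subtype
    have h2 : 0 < Fintype.card (Sᶜ : Set (Fin 4)) := Fintype.card_pos_iff.mpr hSc.to_subtype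
    have h3 : Fintype.card S + Fintype.card (Sᶜ : Set (Fin 4)) = 4 := by
      have := Fintype.card_compl_set S
      have := Fintype.card_subtype_le (· ∈ S)
      simp at *
      omega
    rw [finrank_qubitState_four, Module.finrank_prod, Module.finrank_pi_fintype,
      Module.finrank_pi_fintype]
    simp only [Complex.finrank_real_complex, Finset.sum_const, Finset.card_univ, Fintype.card_fun,
      Fintype.card_fin, smul_eq_mul]
    have h4 : Fintype.card S ≤ 3 := by omega
    have h5 : Fintype.card (Sᶜ : Set (Fin 4)) = 4 - Fintype.card S := by omega
    rw [h5]
    generalize Fintype.card S = n at *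
    interval_cases n <;> norm_num

end NullSets

/-! ### The three claims -/

theorem theorem2 :
    (∀ (z : Fin 4 → ℂ) (h : Fin 4 → GL (Fin 2) ℂ), IsGenericSeed z →
      (ReachableFromOther (seedOrbit h z) ↔
        ∃ p : Fin 4,
          (∃ w : Fin 3, (∀ j, j ≠ p → IsPauliForm w (h j)) ∧ ¬ IsPauliForm w (h p)) ∨
          ((∀ j, j ≠ p → IsTrivialForm (h j)) ∧ ¬ IsTrivialForm (h p)))) ∧
    (∃ (m : ℕ) (f : Fin m → (Fin 12 → ℝ) → QubitState 4),
      (∀ k, ContDiff ℝ ∞ (f k)) ∧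
      ∀ φ : QubitState 4, IsGenericState φ → ReachableFromOther φ →
        ∃ k t, LUEquiv (f k t) φ) ∧
    (∀ᵐ φ : QubitState 4, IsGenericState φ → φ ∈ MES 4) := by
  have family : ∀ φ : QubitState 4, IsGenericState φ → ReachableFromOther φ →
      ∃ k t, LUEquiv (reachableFamily k t) φ := by
    rintro _ ⟨h, z, hz, rfl⟩ hr
    obtain ⟨p, w, hj, -⟩ := (reachable_iff hz h).mp hr
    exact exists_reachableFamily hz h hj
  refine ⟨fun z h hz => ?_, ?_, ?_⟩
  · rw [reachable_iff hz h]
    constructor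
    · rintro ⟨p, w, hw⟩
      exact ⟨p, Or.inl ⟨w, hw⟩⟩
    · rintro ⟨p, ⟨w, hw⟩ | ⟨ht, hp⟩⟩
      · exact ⟨p, w, hw⟩
      -- Trivial operators have every Pauli form, while a nontrivial one misses some form, so (b)
      -- falls under (a).
      · obtain ⟨w, hw⟩ := exists_not_isPauliForm hp
        exact ⟨p, w, fun j hj => (ht j hj).isPauliForm w, hw⟩
  · let e := Fintype.equivFin (Fin 4 × Fin 4 × Fin 3)
    refine ⟨_, fun k => reachableFamily (e.symm k), fun k => contDiff_reachableFamily _,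
      fun φ hφ hr => ?_⟩
    obtain ⟨k, t, hk⟩ := family φ hφ hr
    exact ⟨e k, t, by simpa using hk⟩
  -- True entanglement is needed only almost everywhere, so it suffices that product states form a
  -- null set.
  · have hprod : ∀ᵐ φ : QubitState 4, ∀ S : Set (Fin 4), S.Nonempty → Sᶜ.Nonempty →
        φ ∉ Set.range (productState S) := by
      rw [ae_all_iff]
      intro S
      by_cases hS : S.Nonempty ∧ Sᶜ.Nonempty
      · filter_upwards [measure_eq_zero_iff_ae_notMem.mp (volume_range_productState hS.1 hS.2)]
          with φ hφ _ _ using hφ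
      · exact Filter.Eventually.of_forall fun φ h1 h2 => absurd ⟨h1, h2⟩ hS
    have hreach : ∀ᵐ φ : QubitState 4, ∀ k, φ ∉ Set.range (reachableOrbit k) :=
      ae_all_iff.mpr fun k => measure_eq_zero_iff_ae_notMem.mp (volume_range_reachableOrbit k)
    filter_upwards [hprod, hreach] with φ h1 h2 hφ
    refine ⟨⟨?_, fun S hS hSc => ?_⟩, fun hr => ?_⟩
    · obtain ⟨h, z, hz, rfl⟩ := hφ
      exact seedOrbit_ne_zero hz h
    · rintro ⟨f, g, hfg⟩
      exact h1 S hS hSc ⟨(f, g), funext fun x => (hfg x).symm⟩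
    · obtain ⟨k, t, hk⟩ := family φ hφ hr
      exact h2 k (mem_range_reachableOrbit hk)
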